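/- Let $\alpha\ge 0$ be real and let $n,t,c$ be integers with $0\le t\le n-2$ and $c\ge 1$. For a finite simple graph $G$, let $\Theta(G,\alpha)$ be the largest eigenvalue of $A(G)+\alpha D(G)$, where $A(G)$ is the adjacency matrix and $D(G)$ the diagonal matrix of vertex degrees. A connected simple graph with $m$ vertices is $c$-cyclic if it has $m+c-1$ edges. For a non-increasing sequence $\pi=(d_1,\dots,d_n)$ let $\Gamma(\pi,t;c)$ be the class of all graphs with degree sequence $\pi$ that are the join $K_t\vee H$ of the complete graph $K_t$ and a $c$-cyclic graph $H$ on $n-t$ vertices ($K_0$ being the null graph). A graph $G\in\Gamma(\pi,t;c)$ is $\Theta_\alpha$-maximal if $\Theta(G',\alpha)\le\Theta(G,\alpha)$ for all $G'\in\Gamma(\pi,t;c)$. A pendant vertex is a vertex of degree one. The basic graph $\mathcal B(H)$ of a $c$-cyclic graph $H$ is obtained from $H$ by recursively deleting pendant vertices until none remain. An internal path of a graph $B$ is a sequence $Q=u_1u_2\cdots u_{k+1}$, $k\ge 1$, that is a path, or a cycle if $u_1=u_{k+1}$, such that $d_B(u_1)\ge 3$, $d_B(u_{k+1})\ge 3$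 and $d_B(u_i)=2$ for $2\le i\le k$. A root tree of $H$ with root $r$ is an induced subgraph $T$ of $H$ that is a tree containing $r$ and such that no vertex of $T$ other than $r$ has a neighbour in $H$ outside $T$. **Theorem 3.11.** Let $G_\pi=K_t\vee H$ be $\Theta_\alpha$-maximal in $\Gamma(\pi,t;c)$, where $H$ is $c$-cyclic with minimum degree $\delta(H)=1$, and let $Q=u_1u_2\cdots u_{k+1}$ $(k\ge 1)$ be an internal path of $\mathcal B(H)$. (i) If $u_1=u_{k+1}$, then $k=3$. (ii) If $u_1\ne u_{k+1}$, then $k\le 2$. If moreover $k=2$, then $u_1u_3\in E(H)$ or there is a root tree of $H$ with root $u_2$ that contains all pendant vertices of $H$. -/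

import Mathlib

/-- The join `G ∨ H`: the disjoint union of `G` and `H` together with all edges between them. -/
def joinGraph {V W : Type*} (G : SimpleGraph V) (H : SimpleGraph W) : SimpleGraph (V ⊕ W) :=
  SimpleGraph.sum G H ⊔ completeBipartiteGraph V W

/-- A connected simple graph with `m` edges on `n` vertices is `c`-cyclic if `m = n + c - 1`. -/
def IsCyclicGraph {W : Type*} [Fintype W] (c : ℕ) (H : SimpleGraph W) : Prop :=
  H.Connected ∧ H.edgeSet.ncard + 1 = Fintype.card W + c

/-- `G` is a `t`-cone `c`-cyclic graph on `n` vertices (meaningful for `t + 2 ≤ n`): it is the join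
of the complete graph `K_t` and a `c`-cyclic graph with `n - t` vertices. -/
def IsConeCyclicGraph {n : ℕ} (t c : ℕ) (G : SimpleGraph (Fin n)) : Prop :=
  ∃ H : SimpleGraph (Fin (n - t)), IsCyclicGraph c H ∧
    Nonempty (G ≃g joinGraph (⊤ : SimpleGraph (Fin t)) H)

open Classical in
/-- The vertices of `G` can be enumerated so that their degrees are `π 0, π 1, …`. -/
def HasDegreeSequence {n : ℕ} (G : SimpleGraph (Fin n)) (π : Fin n → ℕ) : Prop :=
  ∃ σ : Equiv.Perm (Fin n), ∀ i, G.degree (σ i) = π i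

/-- The class `Γ(π, t; c)` of `t`-cone `c`-cyclic graphs with degree sequence `π`. -/
def coneClass {n : ℕ} (π : Fin n → ℕ) (t c : ℕ) : Set (SimpleGraph (Fin n)) :=
  {G | IsConeCyclicGraph t c G ∧ HasDegreeSequence G π}

open Classical in
/-- The general matrix `M_α(G) = A(G) + α D(G)`. -/
noncomputable def generalMatrix {V : Type*} [Fintype V] [DecidableEq V] (α : ℝ)
    (G : SimpleGraph V) : Matrix V V ℝ :=
  G.adjMatrix ℝ + α • G.degMatrix ℝ

/-- The general spectral radius `Θ(G, α)`, the largest eigenvalue of the real symmetric matrix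
`M_α(G)`. -/
noncomputable def generalSpectralRadius {V : Type*} [Fintype V] [DecidableEq V] (α : ℝ)
    (G : SimpleGraph V) : ℝ :=
  sSup {μ : ℝ | Module.End.HasEigenvalue (Matrix.toLin' (generalMatrix α G)) μ}

/-- `G` is `Θ_α`-maximal in the class `𝒢`. -/
def IsThetaMaximal {n : ℕ} (α : ℝ) (𝒢 : Set (SimpleGraph (Fin n))) (G : SimpleGraph (Fin n)) :
    Prop :=
  G ∈ 𝒢 ∧ ∀ G' ∈ 𝒢, generalSpectralRadius α G' ≤ generalSpectralRadius α G

/-- The vertices that survive `i` rounds of deletion, where each round deletes all the pendant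
vertices (vertices of degree one) of the graph induced on the vertices that are left. -/
def pruneStage {W : Type*} (H : SimpleGraph W) : ℕ → Set W
  | 0 => Set.univ
  | i + 1 => {v | v ∈ pruneStage H i ∧ (H.neighborSet v ∩ pruneStage H i).ncard ≠ 1}

/-- The vertices that are never deleted when pendant vertices are deleted recursively. -/
def basicVertices {W : Type*} (H : SimpleGraph W) : Set W :=
  ⋂ i, pruneStage H i

/-- The basic graph `B(H)` (used for `c`-cyclic `H` with `c ≥ 1`). -/
def basicGraph {W : Type*} (H : SimpleGraph W) : SimpleGraph (basicVertices H) :=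
  H.induce (basicVertices H)

/-- The walk `Q = u_1 u_2 ⋯ u_{k+1}`, `k ≥ 1`, is an internal path of `G`: it is a path, or a cycle
if `u_1 = u_{k+1}`; its end vertices have degree at least `3`, and `u_2, …, u_k` have degree `2`.
Here `Q.getVert i` is the vertex `u_{i+1}`. -/
structure IsInternalPath {V : Type*} (G : SimpleGraph V) {a b : V} (Q : G.Walk a b) : Prop where
  one_le_length : 1 ≤ Q.length
  isPath_of_ne : a ≠ b → Q.IsPath
  isCycle_of_eq : ∀ h : a = b, (Q.copy rfl h.symm).IsCycle
  three_le_start : 3 ≤ (G.neighborSet a).ncard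
  three_le_end : 3 ≤ (G.neighborSet b).ncard
  inner : ∀ i, 1 ≤ i → i < Q.length → (G.neighborSet (Q.getVert i)).ncard = 2

/-- `T` is the vertex set of a root tree of `H` with root `r`: `H` arises from a tree on `T` and a
graph on the remaining vertices together with `r` by identifying the two copies of `r`; that is,
`H` induces a tree on `T`, and only the root may have neighbours outside `T`. -/
structure IsRootTree {W : Type*} (H : SimpleGraph W) (r : W) (T : Set W) : Prop where
  root_mem : r ∈ T
  isTree : (H.induce T).IsTree
  closed : ∀ x ∈ T, x ≠ r → ∀ y, H.Adj x y → y ∈ T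

/-! Let `x` be the restriction to `H` of a positive Perron vector of `G`. Replacing `H` by a
connected graph whose degrees are those of `H` up to a permutation stays inside the class, so by
Rayleigh's principle it cannot increase the quadratic form at `x`, and if it preserves the form it
preserves every row (`exists_isExtremalWeight`).

Two modifications exploit this. Exchanging edges `p q`, `a b` for `p b`, `q a` changes the form by
`2 (x a - x p) (x q - x b)`, so `x p < x a` forces `x q < x b` whenever the exchange is legal and
keeps the graph connected (`IsExtremalWeight.lt_of_switch`). Moving surplus neighbours from one
vertex to another swaps their degrees, so larger degree means strictly larger weight
(`IsExtremalWeight.lt_of_ncard_lt`).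

Edges of hanging trees are bridges and can be switched against any cycle edge without losing
connectivity, as long as no edge is doubled. Hence vertices of hanging trees, and then the roots
carrying them, are lighter than suitable cycle vertices (`lt_of_rank`, `lt_of_isRoot`). If a vertex
of degree two in the basic graph is heavier than a root of degree at least three, it must itself be
a root. Playing these facts against each other excludes long internal paths on cycles
(`false_of_four_path`) and, when `u₁ u₃` is not an edge, every root other than `u₂`
(`false_of_isRoot_of_ne`).

Internal paths made of bridges are treated separately: each side of such a bridge contains a cycle,
and a hanging tree on one side makes that whole side lighter than the cycles on the other. Wherever
the tree hangs, two of these comparisons conflict once the path has length at least two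
(`isCycleEdge_of_internal`). -/

/-! ### The largest eigenvalue of a real symmetric matrix. -/

theorem finite_eigenvalues {V : Type*} [Fintype V] [DecidableEq V] (M : Matrix V V ℝ) :
    {μ : ℝ | Module.End.HasEigenvalue (Matrix.toLin' M) μ}.Finite :=
  Module.End.finite_hasEigenvalue _

theorem posSemidef_sSup_sub {V : Type*} [Fintype V] [DecidableEq V] {M : Matrix V V ℝ}
    (hM : M.IsHermitian) :
    ((sSup {μ : ℝ | Module.End.HasEigenvalue (Matrix.toLin' M) μ}) • (1 : Matrix V V ℝ)
      - M).PosSemidef := by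
  set θ := sSup {μ : ℝ | Module.End.HasEigenvalue (Matrix.toLin' M) μ} with hθ
  have hN : (θ • (1 : Matrix V V ℝ) - M).IsHermitian := by
    refine Matrix.IsHermitian.sub ?_ hM
    simp [Matrix.IsHermitian]
  rw [hN.posSemidef_iff_eigenvalues_nonneg]
  intro i
  have h1 := hN.mulVec_eigenvectorBasis i
  have hne : (hN.eigenvectorBasis i : V → ℝ) ≠ 0 := by
    intro h
    have := hN.eigenvectorBasis.orthonormal.ne_zero i
    apply this
    ext j
    exact congrFun h j
  have h2 : M.mulVec (hN.eigenvectorBasis i) = (θ - hN.eigenvalues i) • (hN.eigenvectorBasis i : V → ℝ) := by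
    rw [Matrix.sub_mulVec, Matrix.smul_mulVec, Matrix.one_mulVec] at h1
    rw [sub_smul, ← h1]
    abel
  have h3 : Module.End.HasEigenvalue (Matrix.toLin' M) (θ - hN.eigenvalues i) :=
    Module.End.hasEigenvalue_of_hasEigenvector
      (x := (hN.eigenvectorBasis i : V → ℝ))
      ⟨Module.End.mem_eigenspace_iff.mpr (by simpa using h2), hne⟩
  have h4 := le_csSup (finite_eigenvalues M).bddAbove h3
  change θ - hN.eigenvalues i ≤ θ at h4
  simp only [Pi.zero_apply]
  linarith

theorem hasEigenvalue_sSup {V : Type*} [Fintype V] [DecidableEq V] [Nonempty V] {M : Matrix V V ℝ}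
    (hM : M.IsHermitian) :
    Module.End.HasEigenvalue (Matrix.toLin' M)
      (sSup {μ : ℝ | Module.End.HasEigenvalue (Matrix.toLin' M) μ}) := by
  have hne : {μ : ℝ | Module.End.HasEigenvalue (Matrix.toLin' M) μ}.Nonempty := by
    obtain ⟨i⟩ := ‹Nonempty V›
    refine ⟨hM.eigenvalues i, ?_⟩
    refine Module.End.hasEigenvalue_of_hasEigenvector (x := (hM.eigenvectorBasis i : V → ℝ))
      ⟨Module.End.mem_eigenspace_iff.mpr (by simpa using hM.mulVec_eigenvectorBasis i), ?_⟩
    intro h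
    apply hM.eigenvectorBasis.orthonormal.ne_zero i
    ext j
    exact congrFun h j
  exact hne.csSup_mem (finite_eigenvalues M)

/-! ### Rows, the quadratic form and the Perron vector. -/

open Classical in
/-- The entry of `M_α(G) x` at the vertex `v`. -/
noncomputable def weightRow {V : Type*} [Fintype V] (α : ℝ) (G : SimpleGraph V) (x : V → ℝ)
    (v : V) : ℝ :=
  ∑ w, if G.Adj v w then x w + α * x v else 0

/-- The quadratic form of `M_α(G)` at `x`. -/
noncomputable def weightForm {V : Type*} [Fintype V] (α : ℝ) (G : SimpleGraph V) (x : V → ℝ) : ℝ :=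
  ∑ v, x v * weightRow α G x v

theorem generalMatrix_mulVec {V : Type*} [Fintype V] [DecidableEq V] (α : ℝ) (G : SimpleGraph V)
    (x : V → ℝ) : (generalMatrix α G).mulVec x = weightRow α G x := by
  classical
  ext v
  rw [generalMatrix, Matrix.add_mulVec, Matrix.smul_mulVec, Pi.add_apply, Pi.smul_apply,
    SimpleGraph.adjMatrix_mulVec_apply, SimpleGraph.degMatrix, Matrix.mulVec_diagonal, weightRow,
    ← Finset.sum_filter, Finset.sum_add_distrib, Finset.sum_const, ← G.neighborFinset_eq_filter,
    SimpleGraph.card_neighborFinset_eq_degree]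
  simp only [smul_eq_mul, nsmul_eq_mul]
  ring

theorem generalMatrix_isHermitian {V : Type*} [Fintype V] [DecidableEq V] (α : ℝ)
    (G : SimpleGraph V) : (generalMatrix α G).IsHermitian := by
  classical
  unfold generalMatrix
  refine Matrix.IsHermitian.add ?_ ?_
  · rw [Matrix.IsHermitian, Matrix.conjTranspose_eq_transpose_of_trivial]
    exact G.transpose_adjMatrix
  · rw [Matrix.IsHermitian, Matrix.conjTranspose_eq_transpose_of_trivial]
    simp [SimpleGraph.degMatrix]

theorem weightForm_le {V : Type*} [Fintype V] [DecidableEq V] (α : ℝ) (G : SimpleGraph V)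
    (x : V → ℝ) : weightForm α G x ≤ generalSpectralRadius α G * ∑ v, x v * x v := by
  have h := (posSemidef_sSup_sub (generalMatrix_isHermitian α G)).dotProduct_mulVec_nonneg x
  rw [Matrix.sub_mulVec, Matrix.smul_mulVec, Matrix.one_mulVec, generalMatrix_mulVec,
    dotProduct_sub, dotProduct_smul] at h
  simp only [star_trivial, dotProduct, smul_eq_mul] at h
  unfold weightForm generalSpectralRadius
  linarith

/-- A positive semidefinite form vanishes only on the kernel of its matrix, so a vector attaining
the Rayleigh bound is fixed up to the factor `Θ`. -/
theorem weightRow_eq_of_weightForm_eq {V : Type*} [Fintype V] [DecidableEq V] (α : ℝ)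
    (G : SimpleGraph V) (x : V → ℝ)
    (hx : generalSpectralRadius α G * ∑ v, x v * x v ≤ weightForm α G x) (v : V) :
    weightRow α G x v = generalSpectralRadius α G * x v := by
  have h := ((posSemidef_sSup_sub (generalMatrix_isHermitian α G)).dotProduct_mulVec_zero_iff x).1
    (by
      rw [Matrix.sub_mulVec, Matrix.smul_mulVec, Matrix.one_mulVec, generalMatrix_mulVec,
        dotProduct_sub, dotProduct_smul]
      simp only [star_trivial, dotProduct, smul_eq_mul]
      have := weightForm_le α G x
      unfold weightForm generalSpectralRadius at *
      linarith)
  rw [Matrix.sub_mulVec, Matrix.smul_mulVec, Matrix.one_mulVec, generalMatrix_mulVec] at h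
  have := congrFun h v
  simp only [Pi.sub_apply, Pi.smul_apply, smul_eq_mul, Pi.zero_apply] at this
  unfold generalSpectralRadius
  linarith

/-- Taking absolute values of a top eigenvector does not decrease the form, so the result still
satisfies the eigenvalue equation. Its rows are sums of nonnegative terms, so a zero entry would
spread along edges to the whole connected graph. -/
theorem exists_pos_eigenvector {V : Type*} [Fintype V] [DecidableEq V] {α : ℝ} (hα : 0 ≤ α)
    {G : SimpleGraph V} (hG : G.Connected) :
    ∃ x : V → ℝ, (∀ v, 0 < x v) ∧ ∀ v, weightRow α G x v = generalSpectralRadius α G * x v := by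
  classical
  have := hG.nonempty
  obtain ⟨z, hz, hz0⟩ := (hasEigenvalue_sSup (generalMatrix_isHermitian α G)).exists_hasEigenvector
  rw [Module.End.mem_eigenspace_iff, Matrix.toLin'_apply, generalMatrix_mulVec] at hz
  have hzrow : ∀ v, weightRow α G z v = generalSpectralRadius α G * z v := fun v => by
    simpa [generalSpectralRadius] using congrFun hz v
  set x : V → ℝ := fun v => |z v| with hx
  have hform : generalSpectralRadius α G * ∑ v, x v * x v ≤ weightForm α G x := by
    have h1 : generalSpectralRadius α G * ∑ v, x v * x v = weightForm α G z := by
      rw [weightForm, Finset.mul_sum]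
      refine Finset.sum_congr rfl fun v _ => ?_
      rw [hzrow, hx]
      simp only [abs_mul_abs_self]
      ring
    rw [h1, weightForm, weightForm]
    refine Finset.sum_le_sum fun v _ => ?_
    rw [weightRow, weightRow, Finset.mul_sum, Finset.mul_sum]
    refine Finset.sum_le_sum fun w _ => ?_
    split_ifs
    · have h2 : z v * z w ≤ |z v| * |z w| := by
        rw [← abs_mul]; exact le_abs_self _
      have h3 := abs_mul_abs_self (z v)
      simp only [hx]
      nlinarith
    · simp
  have hrow := weightRow_eq_of_weightForm_eq α G x hform
  refine ⟨x, ?_, hrow⟩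
  have hnn : ∀ v, 0 ≤ x v := fun v => abs_nonneg _
  have hstep : ∀ v w, G.Adj v w → x v = 0 → x w = 0 := by
    intro v w hvw hv
    have h0 : weightRow α G x v = 0 := by rw [hrow, hv, mul_zero]
    rw [weightRow, Finset.sum_eq_zero_iff_of_nonneg] at h0
    · simpa [hvw, hv] using h0 w (Finset.mem_univ _)
    · intro u _
      split_ifs
      · have := hnn u; have := hnn v; positivity
      · exact le_rfl
  intro v
  rcases (hnn v).lt_or_eq with h | h
  · exact h
  · exfalso
    apply hz0
    ext w
    obtain ⟨p⟩ := hG.preconnected v w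
    have : x w = 0 := by
      have hv := h.symm
      clear h
      induction p with
      | nil => exact hv
      | cons hadj _ ih => exact ih (hstep _ _ hadj hv)
    simpa [hx] using this

/-! ### From the maximal cone to an extremal weight on `H`. -/

/-- `x` is a positive weight on `H` such that no connected graph with the degrees of `H` (up to a
permutation of the vertices) has a larger form at `x`, and equality of the forms forces equality
of the rows: what a Perron vector of a maximal graph provides. -/
structure IsExtremalWeight {W : Type*} [Fintype W] (α : ℝ) (H : SimpleGraph W) (x : W → ℝ) :
    Prop where
  pos : ∀ v, 0 < x v
  row_eq : ∀ H' : SimpleGraph W, H'.Connected →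
    (∃ τ : Equiv.Perm W, ∀ v, weightRow 0 H' 1 v = weightRow 0 H 1 (τ v)) →
    weightForm α H x ≤ weightForm α H' x → ∀ v, weightRow α H' x v = weightRow α H x v

/-- Degrees are rows for `α = 0` at the constant weight one, so one row formula for a modified graph
yields both its degrees and its form. -/
theorem weightRow_zero_one {V : Type*} [Fintype V] (G : SimpleGraph V) [G.LocallyFinite] (v : V) :
    weightRow 0 G 1 v = G.degree v := by
  classical
  simp only [weightRow, Pi.one_apply, zero_mul, add_zero, Finset.sum_boole]
  rw [← SimpleGraph.card_neighborFinset_eq_degree]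
  congr 2
  ext w
  simp

theorem weightRow_comap {V V' : Type*} [Fintype V] [Fintype V'] (α : ℝ) (G : SimpleGraph V')
    (e : V ≃ V') (x : V → ℝ) (v : V) :
    weightRow α (G.comap e) x v = weightRow α G (x ∘ e.symm) (e v) := by
  classical
  unfold weightRow
  rw [← e.sum_comp]
  simp

theorem weightForm_comap {V V' : Type*} [Fintype V] [Fintype V'] (α : ℝ) (G : SimpleGraph V')
    (e : V ≃ V') (x : V → ℝ) :
    weightForm α (G.comap e) x = weightForm α G (x ∘ e.symm) := by
  unfold weightForm
  rw [← e.sum_comp]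
  simp [weightRow_comap]

theorem weightRow_join_inl {V W : Type*} [Fintype V] [Fintype W] (α : ℝ) (K : SimpleGraph V)
    (H : SimpleGraph W) (x : V ⊕ W → ℝ) (v : V) :
    weightRow α (joinGraph K H) x (.inl v) =
      weightRow α K (x ∘ .inl) v + ∑ w, (x (.inr w) + α * x (.inl v)) := by
  classical
  simp [weightRow, joinGraph, Fintype.sum_sum_type]

theorem weightRow_join_inr {V W : Type*} [Fintype V] [Fintype W] (α : ℝ) (K : SimpleGraph V)
    (H : SimpleGraph W) (x : V ⊕ W → ℝ) (w : W) :
    weightRow α (joinGraph K H) x (.inr w) =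
      ∑ v, (x (.inl v) + α * x (.inr w)) + weightRow α H (x ∘ .inr) w := by
  classical
  simp [weightRow, joinGraph, Fintype.sum_sum_type]

theorem weightForm_join_sub {V W : Type*} [Fintype V] [Fintype W] (α : ℝ) (K : SimpleGraph V)
    (H H' : SimpleGraph W) (x : V ⊕ W → ℝ) :
    weightForm α (joinGraph K H') x - weightForm α (joinGraph K H) x =
      weightForm α H' (x ∘ .inr) - weightForm α H (x ∘ .inr) := by
  simp only [weightForm, Fintype.sum_sum_type, weightRow_join_inl, weightRow_join_inr, mul_add,
    Finset.sum_add_distrib, Function.comp_apply]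
  ring

theorem joinGraph_top_connected {V W : Type*} {H : SimpleGraph W} (hH : H.Connected) :
    (joinGraph (⊤ : SimpleGraph V) H).Connected := by
  obtain ⟨w₀⟩ := hH.nonempty
  have key : ∀ a, (joinGraph (⊤ : SimpleGraph V) H).Reachable a (.inr w₀) := by
    rintro (v | w)
    · exact SimpleGraph.Adj.reachable (by simp [joinGraph])
    · obtain ⟨p⟩ := hH.preconnected w w₀
      induction p with
      | nil => exact SimpleGraph.Reachable.refl _
      | cons h _ ih => exact (SimpleGraph.Adj.reachable (by simpa [joinGraph] using h)).trans ih
  have : Nonempty (V ⊕ W) := ⟨.inr w₀⟩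
  exact ⟨fun a b => (key a).trans (key b).symm⟩

theorem two_mul_ncard_edgeSet {W : Type*} [Fintype W] (H : SimpleGraph W) :
    ((2 * H.edgeSet.ncard : ℕ) : ℝ) = ∑ v, weightRow 0 H 1 v := by
  classical
  simp only [weightRow_zero_one]
  rw [← Nat.cast_sum, H.sum_degrees_eq_twice_card_edges, ← SimpleGraph.coe_edgeFinset,
    Set.ncard_coe_finset]

/-- The join construction only depends on the second factor up to isomorphism. -/
def joinGraphCongrRight {V W W' : Type*} (K : SimpleGraph V) (H : SimpleGraph W) (f : W' ≃ W) :
    joinGraph K (H.comap f) ≃g joinGraph K H where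
  toEquiv := Equiv.sumCongr (Equiv.refl V) f
  map_rel_iff' := by
    rintro (a | a) (b | b) <;> simp [joinGraph]

theorem isCyclicGraph_comap {W W' : Type*} [Fintype W] [Fintype W'] {c : ℕ} {H : SimpleGraph W}
    (hH : IsCyclicGraph c H) (f : W' ≃ W) : IsCyclicGraph c (H.comap f) := by
  refine ⟨(SimpleGraph.Iso.comap f H).connected_iff.2 hH.1, ?_⟩
  have h1 : (H.comap f).edgeSet.ncard = H.edgeSet.ncard := by
    have := (SimpleGraph.Iso.comap f H).mapEdgeSet
    exact Nat.card_congr this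
  rw [h1, Fintype.card_congr f]
  exact hH.2

/-- The form of the new join `G'` at the Perron vector `z` of `G` is at least `Θ(G) ∑ z²` and at
most `Θ(G') ∑ z²`, while `Θ(G') ≤ Θ(G)`. Everything is then an equality, `z` is an eigenvector for
both joins, and cancelling the common contribution of `K_t` compares the rows of `H'` and `H`. -/
theorem exists_isExtremalWeight {n t c : ℕ} {α : ℝ} (hα : 0 ≤ α)
    {π : Fin n → ℕ} {G : SimpleGraph (Fin n)} (hG : IsThetaMaximal α (coneClass π t c) G)
    {W : Type*} [Fintype W] {H : SimpleGraph W} (hH : IsCyclicGraph c H)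
    (hGH : Nonempty (G ≃g joinGraph (⊤ : SimpleGraph (Fin t)) H)) :
    ∃ x, IsExtremalWeight α H x := by
  classical
  obtain ⟨e, rfl⟩ : ∃ e : Fin n ≃ Fin t ⊕ W,
      G = (joinGraph (⊤ : SimpleGraph (Fin t)) H).comap e := by
    obtain ⟨e⟩ := hGH
    refine ⟨e.toEquiv, ?_⟩
    ext i j
    exact e.map_adj_iff.symm
  obtain ⟨z, hzpos, hz⟩ := exists_pos_eigenvector hα
    ((SimpleGraph.Iso.comap e _).connected_iff.2 (joinGraph_top_connected hH.1))
  set y := z ∘ e.symm with hy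
  refine ⟨y ∘ .inr, fun w => hzpos _, fun H' hH' ⟨τ, hτ⟩ hform w => ?_⟩
  set G' := (joinGraph (⊤ : SimpleGraph (Fin t)) H').comap e with hG'
  have hcyc : IsCyclicGraph c H' := by
    refine ⟨hH', ?_⟩
    -- Permuting degrees preserves their sum, hence the number of edges.
    have h1 : ((2 * H'.edgeSet.ncard : ℕ) : ℝ) = ((2 * H.edgeSet.ncard : ℕ) : ℝ) := by
      rw [two_mul_ncard_edgeSet, two_mul_ncard_edgeSet, ← Equiv.sum_comp τ (weightRow 0 H 1)]
      exact Finset.sum_congr rfl fun v _ => hτ v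
    have h2 : 2 * H'.edgeSet.ncard = 2 * H.edgeSet.ncard := by exact_mod_cast h1
    have := hH.2
    omega
  have hcard : Fintype.card W = n - t := by
    have := Fintype.card_congr e
    simp at this
    omega
  have hmem : G' ∈ coneClass π t c := by
    constructor
    · let f : Fin (n - t) ≃ W := (Fintype.equivFinOfCardEq hcard).symm
      exact ⟨H'.comap f, isCyclicGraph_comap hcyc f,
        ⟨(SimpleGraph.Iso.comap e _).trans (joinGraphCongrRight ⊤ H' f).symm⟩⟩
    · obtain ⟨σ, hσ⟩ := hG.1.2
      let ρ : Equiv.Perm (Fin n) :=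
        (e.trans (Equiv.sumCongr (Equiv.refl (Fin t)) τ)).trans e.symm
      have hρ : ∀ i, G'.degree i = ((joinGraph (⊤ : SimpleGraph (Fin t)) H).comap e).degree (ρ i) := by
        intro i
        have : weightRow 0 G' 1 i = weightRow 0 ((joinGraph (⊤ : SimpleGraph (Fin t)) H).comap e) 1 (ρ i) := by
          rw [hG', weightRow_comap, weightRow_comap]
          simp only [ρ, Equiv.trans_apply, Equiv.apply_symm_apply]
          rcases e i with k | w
          · simp [weightRow_join_inl]
          · have := hτ w
            simp only [Equiv.sumCongr_apply, Sum.map_inr, weightRow_join_inr]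
            simpa using this
        rw [weightRow_zero_one, weightRow_zero_one] at this
        exact_mod_cast this
      exact ⟨σ.trans ρ.symm, fun i => by
        rw [← hσ i, ← ρ.apply_symm_apply (σ i)]
        exact hρ (ρ.symm (σ i))⟩
  have hle := hG.2 G' hmem
  have hformG : generalSpectralRadius α ((joinGraph (⊤ : SimpleGraph (Fin t)) H).comap e) * ∑ v, z v * z v = weightForm α ((joinGraph (⊤ : SimpleGraph (Fin t)) H).comap e) z := by
    rw [weightForm, Finset.mul_sum]
    exact Finset.sum_congr rfl fun v _ => by rw [hz]; ring
  have hdiff := weightForm_join_sub α (⊤ : SimpleGraph (Fin t)) H H' y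
  have hGG' : weightForm α ((joinGraph (⊤ : SimpleGraph (Fin t)) H).comap e) z ≤ weightForm α G' z := by
    rw [hG', weightForm_comap, weightForm_comap]
    linarith
  have hnn : 0 ≤ ∑ v, z v * z v := Finset.sum_nonneg fun v _ => mul_self_nonneg _
  have hnn' := mul_le_mul_of_nonneg_right hle hnn
  have hpos : 0 < ∑ v, z v * z v := by
    have hne : (Finset.univ : Finset (Fin n)).Nonempty := ⟨e.symm (.inr w), Finset.mem_univ _⟩
    exact Finset.sum_pos (fun v _ => mul_pos (hzpos v) (hzpos v)) hne
  have heq : generalSpectralRadius α G' = generalSpectralRadius α ((joinGraph (⊤ : SimpleGraph (Fin t)) H).comap e) := by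
    have h1 := weightForm_le α G' z
    refine le_antisymm hle (le_of_mul_le_mul_right ?_ hpos)
    linarith
  have hrow := weightRow_eq_of_weightForm_eq α G' z (by linarith) (e.symm (.inr w))
  have hrow2 := hz (e.symm (.inr w))
  rw [heq, ← hrow2, hG', weightRow_comap, weightRow_comap] at hrow
  simp only [Equiv.apply_symm_apply, weightRow_join_inr] at hrow
  exact add_left_cancel hrow

/-! ### Switching two edges. -/

theorem connected_of_reachable {W : Type*} {H H' : SimpleGraph W} (hH : H.Connected)
    (h : ∀ p q, H.Adj p q → H'.Reachable p q) : H'.Connected := by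
  have := hH.nonempty
  refine ⟨fun a b => ?_⟩
  obtain ⟨p⟩ := hH.preconnected a b
  induction p with
  | nil => exact SimpleGraph.Reachable.refl _
  | cons hadj _ ih => exact (h _ _ hadj).trans ih

/-- The graph obtained from `H` by replacing the edges `p q` and `a b` by `p b` and `q a`. -/
def switchGraph {W : Type*} (H : SimpleGraph W) (p q a b : W) : SimpleGraph W :=
  H.deleteEdges {s(p, q), s(a, b)} ⊔ SimpleGraph.fromEdgeSet {s(p, b), s(q, a)}

open Classical in
/-- The contribution of a possible edge `a b` to the row of `v`. -/
noncomputable def edgeRow {W : Type*} (α : ℝ) (x : W → ℝ) (a b v : W) : ℝ :=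
  (if v = a then x b + α * x a else 0) + (if v = b then x a + α * x b else 0)

theorem sum_edge {W : Type*} [Fintype W] [DecidableEq W] (α : ℝ) (x : W → ℝ) {a b : W}
    (hab : a ≠ b) (v : W) :
    (∑ w, if s(v, w) = s(a, b) then x w + α * x v else 0) = edgeRow α x a b v := by
  unfold edgeRow
  by_cases ha : v = a
  · subst ha
    simp [hab]
  · by_cases hb : v = b
    · subst hb
      simp [hab.symm]
    · simp [ha, hb]

theorem sum_mul_edgeRow {W : Type*} [Fintype W] (α : ℝ) (x : W → ℝ) (a b : W) :
    ∑ v, x v * edgeRow α x a b v = 2 * (x a * x b) + α * (x a * x a + x b * x b) := by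
  classical
  simp [edgeRow, mul_add, Finset.sum_add_distrib]
  ring

theorem weightRow_switchGraph {W : Type*} [Fintype W] (α : ℝ) (x : W → ℝ) {H : SimpleGraph W}
    {p q a b : W} (hpq : H.Adj p q) (hab : H.Adj a b) (hpb : ¬ H.Adj p b) (hqa : ¬ H.Adj q a)
    (hpb' : p ≠ b) (hqa' : q ≠ a) (hpa : p ≠ a) (v : W) :
    weightRow α (switchGraph H p q a b) x v =
      weightRow α H x v - edgeRow α x p q v - edgeRow α x a b v + edgeRow α x p b v
        + edgeRow α x q a v := by
  classical
  rw [← sum_edge α x hpq.ne, ← sum_edge α x hab.ne, ← sum_edge α x hpb', ← sum_edge α x hqa',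
    weightRow, weightRow, ← Finset.sum_sub_distrib, ← Finset.sum_sub_distrib,
    ← Finset.sum_add_distrib, ← Finset.sum_add_distrib]
  refine Finset.sum_congr rfl fun w _ => ?_
  have hadj : (switchGraph H p q a b).Adj v w ↔
      (H.Adj v w ∧ s(v, w) ≠ s(p, q) ∧ s(v, w) ≠ s(a, b)) ∨ s(v, w) = s(p, b) ∨
        s(v, w) = s(q, a) := by
    simp only [switchGraph, SimpleGraph.sup_adj, SimpleGraph.deleteEdges_adj,
      SimpleGraph.fromEdgeSet_adj, Set.mem_insert_iff, Set.mem_singleton_iff]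
    constructor
    · tauto
    · rintro (h | h)
      · left; tauto
      · right
        refine ⟨h, ?_⟩
        rintro rfl
        rcases h with h | h
        · have := Sym2.eq_iff.1 h; aesop
        · have := Sym2.eq_iff.1 h; aesop
  have hmem : ∀ c d, (s(v, w) = s(c, d)) → (H.Adj v w ↔ H.Adj c d) := by
    intro c d h
    rw [← SimpleGraph.mem_edgeSet, h, SimpleGraph.mem_edgeSet]
  have hqb : q ≠ b := by rintro rfl; exact hpb hpq
  by_cases h1 : s(v, w) = s(p, q)
  · have n1 : s(p, q) ≠ s(a, b) := by
      intro h; rcases Sym2.eq_iff.1 h with h | h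
      · exact hpa h.1
      · exact hpb' h.1
    have n2 : s(p, q) ≠ s(p, b) := by
      intro h; rcases Sym2.eq_iff.1 h with h | h
      · exact hqb h.2
      · exact hpb' h.1
    have n3 : s(p, q) ≠ s(q, a) := by
      intro h; rcases Sym2.eq_iff.1 h with h | h
      · exact hqa' h.2
      · exact hpa h.1
    have := (hmem _ _ h1).2 hpq
    simp [hadj, this, h1, n1, n2, n3]
  by_cases h2 : s(v, w) = s(a, b)
  · have n2 : s(a, b) ≠ s(p, b) := by
      intro h; rcases Sym2.eq_iff.1 h with h | h
      · exact hpa h.1.symm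
      · exact hpb' h.2.symm
    have n3 : s(a, b) ≠ s(q, a) := by
      intro h; rcases Sym2.eq_iff.1 h with h | h
      · exact hqa' h.1.symm
      · exact hqb h.2.symm
    have := (hmem _ _ h2).2 hab
    simp only [hadj, this, h2, n2, n3, h2 ▸ h1]
    simp
  by_cases h3 : s(v, w) = s(p, b)
  · have n3 : s(p, b) ≠ s(q, a) := by
      intro h; rcases Sym2.eq_iff.1 h with h | h
      · exact hpq.ne h.1
      · exact hpa h.1
    have h0 : ¬ H.Adj v w := fun h => hpb ((hmem _ _ h3).1 h)
    simp only [hadj, h0, h3, n3, h3 ▸ h1, h3 ▸ h2]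
    simp
  by_cases h4 : s(v, w) = s(q, a)
  · have h0 : ¬ H.Adj v w := fun h => hqa ((hmem _ _ h4).1 h)
    simp only [hadj, h0, h4, h4 ▸ h1, h4 ▸ h2, h4 ▸ h3]
    simp
  simp [hadj, h1, h2, h3, h4]

/-- If `x b ≤ x q`, the switch does not decrease the form, so the row of `q` is unchanged; but there
`p` has been replaced by the heavier `a`. The new edges `p b` and `q a` reduce connectivity to any
one of the three alternatives in `hconn`. -/
theorem IsExtremalWeight.lt_of_switch {W : Type*} [Fintype W] {α : ℝ} {H : SimpleGraph W}
    {x : W → ℝ} (hx : IsExtremalWeight α H x) (hH : H.Connected)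
    {p q a b : W} (hpq : H.Adj p q) (hab : H.Adj a b) (hpb : ¬ H.Adj p b) (hqa : ¬ H.Adj q a)
    (hpb' : p ≠ b) (hqa' : q ≠ a)
    (hconn : (H.deleteEdges {s(p, q), s(a, b)}).Reachable a b ∨
      (H.deleteEdges {s(p, q), s(a, b)}).Reachable p q ∨ H.Adj p a)
    (hlt : x p < x a) : x q < x b := by
  classical
  by_contra! hle
  have hpa : p ≠ a := by rintro rfl; exact lt_irrefl _ hlt
  have hqb : q ≠ b := by rintro rfl; exact hpb hpq
  have hrow := fun β y => weightRow_switchGraph β y hpq hab hpb hqa hpb' hqa' hpa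
  have hle' : H.deleteEdges {s(p, q), s(a, b)} ≤ switchGraph H p q a b := le_sup_left
  have r1 : (switchGraph H p q a b).Reachable p b := SimpleGraph.Adj.reachable <| by
    simp [switchGraph, hpb']
  have r2 : (switchGraph H p q a b).Reachable q a := SimpleGraph.Adj.reachable <| by
    simp [switchGraph, hqa']
  have r3 : (switchGraph H p q a b).Reachable a b := by
    rcases hconn with h | h | h
    · exact h.mono hle'
    · exact r2.symm.trans ((h.mono hle').symm.trans r1)
    · refine (SimpleGraph.Adj.reachable (hle' ?_)).symm.trans r1
      have m1 : s(p, a) ≠ s(p, q) := by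
        intro h; rcases Sym2.eq_iff.1 h with h | h
        · exact hqa' h.2.symm
        · exact hpq.ne h.1
      have m2 : s(p, a) ≠ s(a, b) := by
        intro h; rcases Sym2.eq_iff.1 h with h | h
        · exact hpa h.1
        · exact hpb' h.1
      rw [SimpleGraph.deleteEdges_adj]
      exact ⟨h, by simp [m1, m2]⟩
  have hc : (switchGraph H p q a b).Connected := by
    refine connected_of_reachable hH fun c d hcd => ?_
    by_cases h1 : s(c, d) = s(p, q)
    · have : (switchGraph H p q a b).Reachable p q := r1.trans (r3.symm.trans r2.symm)
      rcases Sym2.eq_iff.1 h1 with ⟨rfl, rfl⟩ | ⟨rfl, rfl⟩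
      · exact this
      · exact this.symm
    by_cases h2 : s(c, d) = s(a, b)
    · rcases Sym2.eq_iff.1 h2 with ⟨rfl, rfl⟩ | ⟨rfl, rfl⟩
      · exact r3
      · exact r3.symm
    · refine SimpleGraph.Adj.reachable (hle' ?_)
      rw [SimpleGraph.deleteEdges_adj]
      exact ⟨hcd, by simp only [Set.mem_insert_iff, Set.mem_singleton_iff]; tauto⟩
  have hdeg : ∀ v, weightRow 0 (switchGraph H p q a b) 1 v = weightRow 0 H 1 v := by
    intro v
    rw [hrow]
    simp only [edgeRow, Pi.one_apply]
    ring
  have hform : weightForm α H x ≤ weightForm α (switchGraph H p q a b) x := by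
    have : weightForm α (switchGraph H p q a b) x = weightForm α H x
        + 2 * ((x a - x p) * (x q - x b)) := by
      unfold weightForm
      simp only [hrow, mul_add, mul_sub, Finset.sum_add_distrib, Finset.sum_sub_distrib,
        sum_mul_edgeRow]
      ring
    rw [this]
    have := mul_nonneg (sub_nonneg.2 hlt.le) (sub_nonneg.2 hle)
    linarith
  have h := hx.row_eq _ hc ⟨1, hdeg⟩ hform q
  rw [hrow] at h
  simp only [edgeRow, hqa', hqb, hpq.ne.symm, if_true, if_false] at h
  linarith

/-! ### Moving neighbours: larger degree gives larger weight. -/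

theorem weightRow_zero_one_eq_ncard {V : Type*} [Fintype V] (G : SimpleGraph V) (v : V) :
    weightRow 0 G 1 v = (G.neighborSet v).ncard := by
  classical
  rw [weightRow_zero_one, ← SimpleGraph.card_neighborFinset_eq_degree,
    SimpleGraph.neighborFinset_def, Set.ncard_eq_toFinset_card']

/-- The graph obtained from `H` by replacing the edges `u m` with `v m` for all `m ∈ M`. -/
def moveGraph {W : Type*} (H : SimpleGraph W) (u v : W) (M : Finset W) : SimpleGraph W :=
  H.deleteEdges {e | ∃ m ∈ M, e = s(u, m)} ⊔ SimpleGraph.fromEdgeSet {e | ∃ m ∈ M, e = s(v, m)}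

theorem sum_ite_sym2 {W : Type*} [DecidableEq W] (M : Finset W) (e : Sym2 W) (u : W) (r : ℝ)
    [Decidable (∃ m ∈ M, e = s(u, m))] :
    (∑ m ∈ M, if e = s(u, m) then r else 0) = if ∃ m ∈ M, e = s(u, m) then r else 0 := by
  split_ifs with h
  · obtain ⟨m, hm, rfl⟩ := h
    rw [Finset.sum_eq_single m]
    · simp
    · intro m' _ hne
      rw [if_neg]
      intro h
      exact hne (Sym2.congr_right.1 h).symm
    · exact fun h => absurd hm h
  · push Not at h
    exact Finset.sum_eq_zero fun m hm => if_neg (h m hm)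

theorem weightRow_moveGraph {W : Type*} [Fintype W] (α : ℝ) (x : W → ℝ) {H : SimpleGraph W}
    {u v : W} {M : Finset W} (hu : ∀ m ∈ M, H.Adj u m) (hv : ∀ m ∈ M, ¬ H.Adj v m)
    (hvM : v ∉ M) (w : W) :
    weightRow α (moveGraph H u v M) x w =
      weightRow α H x w + ∑ m ∈ M, (edgeRow α x v m w - edgeRow α x u m w) := by
  classical
  have h1 : ∑ m ∈ M, (edgeRow α x v m w - edgeRow α x u m w) =
      ∑ z, ((if ∃ m ∈ M, s(w, z) = s(v, m) then x z + α * x w else 0)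
        - if ∃ m ∈ M, s(w, z) = s(u, m) then x z + α * x w else 0) := by
    simp only [← sum_ite_sym2]
    rw [Finset.sum_sub_distrib, Finset.sum_sub_distrib, Finset.sum_comm,
      Finset.sum_comm (s := Finset.univ) (t := M)]
    congr 1
    · refine Finset.sum_congr rfl fun m hm => (sum_edge α x ?_ w).symm
      rintro rfl
      exact hvM hm
    · exact Finset.sum_congr rfl fun m hm => (sum_edge α x (hu m hm).ne w).symm
  rw [h1, weightRow, weightRow, ← Finset.sum_add_distrib]
  refine Finset.sum_congr rfl fun z _ => ?_
  have hmem : ∀ c d, (s(w, z) = s(c, d)) → (H.Adj w z ↔ H.Adj c d) := by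
    intro c d h
    rw [← SimpleGraph.mem_edgeSet, h, SimpleGraph.mem_edgeSet]
  have hadj : (moveGraph H u v M).Adj w z ↔ (H.Adj w z ∧ ¬ ∃ m ∈ M, s(w, z) = s(u, m)) ∨
      ∃ m ∈ M, s(w, z) = s(v, m) := by
    simp only [moveGraph, SimpleGraph.sup_adj, SimpleGraph.deleteEdges_adj,
      SimpleGraph.fromEdgeSet_adj, Set.mem_ofPred_eq]
    refine or_congr Iff.rfl (and_iff_left_of_imp ?_)
    rintro ⟨m, hm, h⟩ rfl
    rcases Sym2.eq_iff.1 h with ⟨rfl, rfl⟩ | ⟨rfl, rfl⟩ <;> exact hvM hm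
  have hQ : (∃ m ∈ M, s(w, z) = s(v, m)) → ¬ H.Adj w z := by
    rintro ⟨m, hm, h⟩ h'
    exact hv m hm ((hmem _ _ h).1 h')
  have hR : (∃ m ∈ M, s(w, z) = s(u, m)) → H.Adj w z := by
    rintro ⟨m, hm, h⟩
    exact (hmem _ _ h).2 (hu m hm)
  simp only [hadj]
  by_cases hP : H.Adj w z
  · have : ¬ ∃ m ∈ M, s(w, z) = s(v, m) := fun h => hQ h hP
    by_cases h : ∃ m ∈ M, s(w, z) = s(u, m)
    · simp only [hP, this, h]; simp
    · simp only [hP, this, h]; simp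
  · have : ¬ ∃ m ∈ M, s(w, z) = s(u, m) := fun h => hP (hR h)
    simp only [hP, this]
    simp

/-- By `hcard` the move exchanges the degrees of `u` and `v`. If `x u ≤ x v`, the form does not
decrease, yet the row of `v` gains positive terms. -/
theorem IsExtremalWeight.lt_of_move {W : Type*} [Fintype W] {α : ℝ} (hα : 0 ≤ α)
    {H : SimpleGraph W} {x : W → ℝ} (hx : IsExtremalWeight α H x) (hH : H.Connected) {u v : W}
    {M : Finset W} (hu : ∀ m ∈ M, H.Adj u m) (hv : ∀ m ∈ M, ¬ H.Adj v m) (hvM : v ∉ M)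
    (hM : M.Nonempty) (hcard : (H.neighborSet v).ncard + M.card = (H.neighborSet u).ncard)
    (hconn : (moveGraph H u v M).Reachable u v) : x v < x u := by
  classical
  by_contra! hle
  have huv : u ≠ v := by
    rintro rfl
    have := hM.card_pos
    omega
  have hrow := fun β y => weightRow_moveGraph β y hu hv hvM
  have hc : (moveGraph H u v M).Connected := by
    have r1 : ∀ m ∈ M, (moveGraph H u v M).Reachable v m := fun m hm =>
      SimpleGraph.Adj.reachable <| by
        simp only [moveGraph, SimpleGraph.sup_adj, SimpleGraph.fromEdgeSet_adj]
        refine Or.inr ⟨⟨m, hm, rfl⟩, ?_⟩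
        rintro rfl
        exact hvM hm
    refine connected_of_reachable hH fun c d hcd => ?_
    by_cases h : ∃ m ∈ M, s(c, d) = s(u, m)
    · obtain ⟨m, hm, h⟩ := h
      rcases Sym2.eq_iff.1 h with ⟨rfl, rfl⟩ | ⟨rfl, rfl⟩
      · exact hconn.trans (r1 _ hm)
      · exact (hconn.trans (r1 _ hm)).symm
    · refine SimpleGraph.Adj.reachable ?_
      simp only [moveGraph, SimpleGraph.sup_adj, SimpleGraph.deleteEdges_adj]
      exact Or.inl ⟨hcd, h⟩
  have hdeg : ∀ w, weightRow 0 (moveGraph H u v M) 1 w = weightRow 0 H 1 (Equiv.swap u v w) := by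
    intro w
    have h1 : ∑ m ∈ M, (edgeRow 0 (1 : W → ℝ) v m w - edgeRow 0 1 u m w) =
        M.card * ((if w = v then 1 else 0) - if w = u then 1 else 0) := by
      simp only [edgeRow, Pi.one_apply, zero_mul, add_zero]
      rw [← nsmul_eq_mul, ← Finset.sum_const]
      exact Finset.sum_congr rfl fun m _ => by ring
    have h2 : ((H.neighborSet v).ncard : ℝ) + M.card = (H.neighborSet u).ncard := by
      exact_mod_cast hcard
    rw [hrow, h1]
    simp only [weightRow_zero_one_eq_ncard]
    by_cases hwu : w = u
    · subst hwu
      rw [Equiv.swap_apply_left]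
      simp [huv]
      linarith
    · by_cases hwv : w = v
      · subst hwv
        rw [Equiv.swap_apply_right]
        simp [huv.symm]
        linarith
      · rw [Equiv.swap_apply_of_ne_of_ne hwu hwv]
        simp [hwu, hwv]
  have hform : weightForm α H x ≤ weightForm α (moveGraph H u v M) x := by
    have h1 : weightForm α (moveGraph H u v M) x = weightForm α H x
        + ∑ m ∈ M, (2 * ((x v - x u) * x m) + α * (x v * x v - x u * x u)) := by
      unfold weightForm
      simp only [hrow, mul_add (x _), Finset.sum_add_distrib (s := Finset.univ), Finset.mul_sum]
      rw [Finset.sum_comm]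
      congr 1
      refine Finset.sum_congr rfl fun m _ => ?_
      simp only [mul_sub (x _), Finset.sum_sub_distrib (s := Finset.univ), sum_mul_edgeRow]
      ring
    rw [h1, le_add_iff_nonneg_right]
    refine Finset.sum_nonneg fun m _ => ?_
    have h2 := mul_nonneg (sub_nonneg.2 hle) (hx.pos m).le
    have h3 : 0 ≤ x v * x v - x u * x u :=
      sub_nonneg.2 (mul_self_le_mul_self (hx.pos u).le hle)
    have h4 := mul_nonneg hα h3
    linarith
  have h := hx.row_eq _ hc ⟨_, hdeg⟩ hform v
  rw [hrow, add_eq_left] at h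
  refine absurd h (ne_of_gt (Finset.sum_pos (fun m hm => ?_) hM))
  have hvm : v ≠ m := by rintro rfl; exact hvM hm
  simp only [edgeRow, hvm, huv.symm, if_true, if_false]
  have := hx.pos m
  have := mul_nonneg hα (hx.pos v).le
  linarith

theorem IsExtremalWeight.lt_of_ncard_lt {W : Type*} [Fintype W] {α : ℝ} (hα : 0 ≤ α)
    {H : SimpleGraph W} {x : W → ℝ} (hx : IsExtremalWeight α H x) (hH : H.Connected) {u v : W}
    (hlt : (H.neighborSet v).ncard < (H.neighborSet u).ncard) : x v < x u := by
  classical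
  have huv : u ≠ v := by rintro rfl; exact lt_irrefl _ hlt
  -- It suffices to find enough neighbours to move, keeping a path between `u` and `v`.
  suffices ∃ S : Set W, S ⊆ H.neighborSet u ∧ (∀ m ∈ S, ¬ H.Adj v m) ∧ v ∉ S ∧
      (H.neighborSet u).ncard ≤ (H.neighborSet v).ncard + S.ncard ∧
      (H.deleteEdges {e | ∃ m ∈ S, e = s(u, m)}).Reachable u v by
    obtain ⟨S, hSu, hSv, hvS, hS, hr⟩ := this
    obtain ⟨M, hMS, hM⟩ : ∃ M ⊆ S.toFinset,
        M.card = (H.neighborSet u).ncard - (H.neighborSet v).ncard := by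
      apply Finset.exists_subset_card_eq
      rw [← Set.ncard_eq_toFinset_card']
      omega
    have hMS' : ∀ m ∈ M, m ∈ S := fun m hm => by simpa using hMS hm
    refine hx.lt_of_move hα hH (fun m hm => hSu (hMS' m hm)) (fun m hm => hSv m (hMS' m hm))
      (fun h => hvS (hMS' _ h)) (Finset.card_pos.1 (by omega)) (by omega)
      (hr.mono (le_trans ?_ le_sup_left))
    exact H.deleteEdges_anti fun e ⟨m, hm, h⟩ => ⟨m, hMS' m hm, h⟩
  obtain ⟨p, hp⟩ := hH.exists_isPath u v
  -- At distance at most two, only neighbours of `u` outside `{v} ∪ N(v)` move, so a shortest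
  -- connection survives. Otherwise every neighbour of `u` may move except the first vertex `w` of a
  -- path to `v`; giving up `w` is affordable because `v` has degree at least one.
  by_cases hcase : H.Adj u v ∨ ∃ w, H.Adj u w ∧ H.Adj v w
  · refine ⟨H.neighborSet u \ insert v (H.neighborSet v), Set.sdiff_subset, fun m hm h => ?_,
      fun h => h.2 (Set.mem_insert _ _), ?_, ?_⟩
    · exact hm.2 (Set.mem_insert_of_mem _ h)
    · rcases em (H.Adj u v) with h | h
      -- As `u` is not its own neighbour, it may be dropped from `N(v)`, which pays for the inserted
      -- `v`.
      · have h1 : H.neighborSet u \ insert v (H.neighborSet v)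
            = H.neighborSet u \ (insert v (H.neighborSet v \ {u})) := by
          ext z
          simp only [Set.mem_sdiff, Set.mem_insert_iff, SimpleGraph.mem_neighborSet,
            Set.mem_singleton_iff]
          have : H.Adj u z → z ≠ u := fun h => h.ne.symm
          tauto
        have h2 : (insert v (H.neighborSet v \ {u})).ncard ≤ (H.neighborSet v).ncard := by
          refine (Set.ncard_insert_le _ _).trans ?_
          rw [Set.ncard_sdiff_singleton_add_one (show u ∈ H.neighborSet v from h.symm)]
        have := Set.ncard_le_ncard_sdiff_add_ncard (H.neighborSet u)
          (insert v (H.neighborSet v \ {u}))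
        rw [h1]
        omega
      · have h1 : H.neighborSet u \ insert v (H.neighborSet v)
            = H.neighborSet u \ H.neighborSet v := by
          ext z
          simp only [Set.mem_sdiff, Set.mem_insert_iff, SimpleGraph.mem_neighborSet]
          have : H.Adj u z → z ≠ v := by rintro h' rfl; exact h h'
          tauto
        have := Set.ncard_le_ncard_sdiff_add_ncard (H.neighborSet u) (H.neighborSet v)
        rw [h1]
        omega
    · rcases hcase with h | ⟨w, h1, h2⟩
      · refine SimpleGraph.Adj.reachable ?_
        rw [SimpleGraph.deleteEdges_adj]
        refine ⟨h, ?_⟩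
        rintro ⟨m, hm, hs⟩
        rw [← Sym2.congr_right.1 hs] at hm
        exact hm.2 (Set.mem_insert _ _)
      · refine (SimpleGraph.Adj.reachable (v := w) ?_).trans (SimpleGraph.Adj.reachable ?_)
        · rw [SimpleGraph.deleteEdges_adj]
          refine ⟨h1, ?_⟩
          rintro ⟨m, hm, hs⟩
          rw [← Sym2.congr_right.1 hs] at hm
          exact hm.2 (Set.mem_insert_of_mem _ h2)
        · rw [SimpleGraph.deleteEdges_adj]
          refine ⟨h2.symm, ?_⟩
          rintro ⟨m, hm, hs⟩
          rcases Sym2.eq_iff.1 hs with ⟨rfl, _⟩ | ⟨_, rfl⟩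
          · exact h1.ne rfl
          · exact huv rfl
  · push Not at hcase
    cases p with
    | nil => exact absurd rfl huv
    | @cons _ w _ hadj p =>
      rw [SimpleGraph.Walk.cons_isPath_iff] at hp
      refine ⟨H.neighborSet u \ {w}, Set.sdiff_subset, fun m hm => hcase.2 m hm.1,
        fun h => hcase.1 h.1, ?_, ?_⟩
      · have h1 := Set.ncard_sdiff_singleton_add_one (show w ∈ H.neighborSet u from hadj)
        have h2 : 0 < (H.neighborSet v).ncard := by
          rw [Set.ncard_pos]
          have : ¬ p.Nil := by
            intro h
            exact hcase.1 (h.eq ▸ hadj)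
          exact ⟨_, (p.adj_penultimate this).symm⟩
        omega
      · refine (SimpleGraph.Adj.reachable (v := w) ?_).trans ⟨p.toDeleteEdges _ ?_⟩
        · rw [SimpleGraph.deleteEdges_adj]
          refine ⟨hadj, ?_⟩
          rintro ⟨m, hm, hs⟩
          exact hm.2 (Sym2.congr_right.1 hs).symm
        · rintro e he ⟨m, hm, rfl⟩
          exact hp.2 (p.fst_mem_support_of_mem_edges he)

/-! ### Cycle edges, bridges and the basic graph. -/

/-- The edge `u v` of `H` is not a bridge, that is, it lies on a cycle. -/
def IsCycleEdge {W : Type*} (H : SimpleGraph W) (u v : W) : Prop :=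
  H.Adj u v ∧ (H.deleteEdges {s(u, v)}).Reachable u v

/-- The edge `u v` of `H` is a bridge. -/
def IsCutEdge {W : Type*} (H : SimpleGraph W) (u v : W) : Prop :=
  H.Adj u v ∧ ¬ (H.deleteEdges {s(u, v)}).Reachable u v

theorem IsCycleEdge.symm {W : Type*} {H : SimpleGraph W} {u v : W} (h : IsCycleEdge H u v) :
    IsCycleEdge H v u :=
  ⟨h.1.symm, by rw [Sym2.eq_swap]; exact h.2.symm⟩

theorem IsCutEdge.symm {W : Type*} {H : SimpleGraph W} {u v : W} (h : IsCutEdge H u v) :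
    IsCutEdge H v u :=
  ⟨h.1.symm, by rw [Sym2.eq_swap]; exact fun h' => h.2 h'.symm⟩

theorem isCycleEdge_or_isCutEdge {W : Type*} {H : SimpleGraph W} {u v : W} (h : H.Adj u v) :
    IsCycleEdge H u v ∨ IsCutEdge H u v := by
  by_cases h' : (H.deleteEdges {s(u, v)}).Reachable u v
  · exact Or.inl ⟨h, h'⟩
  · exact Or.inr ⟨h, h'⟩

theorem IsCutEdge.not_isCycleEdge {W : Type*} {H : SimpleGraph W} {u v : W}
    (h : IsCutEdge H u v) : ¬ IsCycleEdge H u v := fun h' => h.2 h'.2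

theorem isCycleEdge_iff {W : Type*} {H : SimpleGraph W} {u v : W} :
    IsCycleEdge H u v ↔ ∃ (w : W) (p : H.Walk w w), p.IsCycle ∧ s(u, v) ∈ p.edges :=
  SimpleGraph.adj_and_reachable_delete_edges_iff_exists_cycle

/-- As long as all of `Z` is present, none of its vertices is pendant. The case of interest is the
vertex set of a cycle. -/
theorem subset_basicVertices {W : Type*} {H : SimpleGraph W} {Z : Set W}
    (hZ : ∀ v ∈ Z, ∃ a ∈ Z, ∃ b ∈ Z, a ≠ b ∧ H.Adj v a ∧ H.Adj v b) : Z ⊆ basicVertices H := by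
  refine Set.subset_iInter fun i => ?_
  induction i with
  | zero => exact Set.subset_univ _
  | succ i ih =>
    refine fun v hv => ⟨ih hv, fun h => ?_⟩
    obtain ⟨a, ha, b, hb, hab, h1, h2⟩ := hZ v hv
    obtain ⟨c, hc⟩ := Set.ncard_eq_one.1 h
    have ha' : a ∈ H.neighborSet v ∩ pruneStage H i := ⟨h1, ih ha⟩
    have hb' : b ∈ H.neighborSet v ∩ pruneStage H i := ⟨h2, ih hb⟩
    rw [hc] at ha' hb'
    exact hab (ha'.trans hb'.symm)

theorem exists_two_of_mem_cycle {W : Type*} {H : SimpleGraph W} {w : W} {p : H.Walk w w}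
    (hp : p.IsCycle) {v : W} (hv : v ∈ p.support) :
    ∃ a b, a ≠ b ∧ s(v, a) ∈ p.edges ∧ s(v, b) ∈ p.edges := by
  obtain ⟨a, b, hab, h⟩ := Set.ncard_eq_two.1 (hp.ncard_neighborSet_toSubgraph_eq_two hv)
  refine ⟨a, b, hab, ?_, ?_⟩
  · have : a ∈ p.toSubgraph.neighborSet v := by rw [h]; simp
    exact SimpleGraph.Walk.adj_toSubgraph_iff_mem_edges.1 this
  · have : b ∈ p.toSubgraph.neighborSet v := by rw [h]; simp
    exact SimpleGraph.Walk.adj_toSubgraph_iff_mem_edges.1 this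

theorem IsCycleEdge.left_mem {W : Type*} {H : SimpleGraph W} {u v : W}
    (h : IsCycleEdge H u v) : u ∈ basicVertices H := by
  obtain ⟨w, p, hp, he⟩ := isCycleEdge_iff.1 h
  refine subset_basicVertices (Z := {z | z ∈ p.support}) (fun z hz => ?_)
    (p.fst_mem_support_of_mem_edges he)
  obtain ⟨a, b, hab, ha, hb⟩ := exists_two_of_mem_cycle hp hz
  exact ⟨a, p.snd_mem_support_of_mem_edges ha, b, p.snd_mem_support_of_mem_edges hb, hab,
    p.adj_of_mem_edges ha, p.adj_of_mem_edges hb⟩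

theorem IsCycleEdge.right_mem {W : Type*} {H : SimpleGraph W} {u v : W}
    (h : IsCycleEdge H u v) : v ∈ basicVertices H := h.symm.left_mem

theorem IsCycleEdge.exists_ne {W : Type*} {H : SimpleGraph W} {u v : W}
    (h : IsCycleEdge H u v) : ∃ v', v' ≠ v ∧ IsCycleEdge H u v' := by
  obtain ⟨w, p, hp, he⟩ := isCycleEdge_iff.1 h
  obtain ⟨a, b, hab, ha, hb⟩ := exists_two_of_mem_cycle hp (p.fst_mem_support_of_mem_edges he)
  by_cases hav : a = v
  · exact ⟨b, fun hbv => hab (hav.trans hbv.symm), isCycleEdge_iff.2 ⟨w, p, hp, hb⟩⟩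
  · exact ⟨a, hav, isCycleEdge_iff.2 ⟨w, p, hp, ha⟩⟩

theorem isCutEdge_of_notMem {W : Type*} {H : SimpleGraph W} {u v : W} (h : H.Adj u v)
    (hu : u ∉ basicVertices H) : IsCutEdge H u v :=
  (isCycleEdge_or_isCutEdge h).resolve_left fun h' => hu h'.left_mem

/-- Inner vertices keep two neighbours on the path and the ends never fall, so no round can break
the path. -/
theorem mem_basicVertices_of_isPath {W : Type*} {H : SimpleGraph W} {a b : W} {p : H.Walk a b}
    (hp : p.IsPath) (ha : a ∈ basicVertices H) (hb : b ∈ basicVertices H) {w : W}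
    (hw : w ∈ p.support) : w ∈ basicVertices H := by
  refine Set.mem_iInter.2 fun i => ?_
  induction i generalizing w with
  | zero => trivial
  | succ i ih =>
    obtain ⟨j, rfl, hj⟩ := SimpleGraph.Walk.mem_support_iff_exists_getVert.1 hw
    rcases Nat.eq_zero_or_pos j with rfl | hj0
    · rw [p.getVert_zero]
      exact Set.mem_iInter.1 ha (i + 1)
    rcases hj.lt_or_eq with hlt | rfl
    · refine ⟨ih hw, fun h => ?_⟩
      obtain ⟨c, hc⟩ := Set.ncard_eq_one.1 h
      have h1 : p.getVert (j - 1) ∈ H.neighborSet (p.getVert j) ∩ pruneStage H i := by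
        refine ⟨?_, ih (p.getVert_mem_support _)⟩
        have := p.adj_getVert_succ (i := j - 1) (by omega)
        rw [Nat.sub_add_cancel hj0] at this
        exact this.symm
      have h2 : p.getVert (j + 1) ∈ H.neighborSet (p.getVert j) ∩ pruneStage H i :=
        ⟨p.adj_getVert_succ hlt, ih (p.getVert_mem_support _)⟩
      rw [hc] at h1 h2
      have h3 := hp.getVert_injOn (x₁ := j - 1) (x₂ := j + 1) (by show j - 1 ≤ _; omega)
        (by show j + 1 ≤ _; omega) (h1.trans h2.symm)
      omega
    · rw [p.getVert_length]
      exact Set.mem_iInter.1 hb (i + 1)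

theorem pruneStage_antitone {W : Type*} (H : SimpleGraph W) : Antitone (pruneStage H) :=
  antitone_nat_of_succ_le fun _ _ hv => hv.1

theorem exists_pruneStage_eq {W : Type*} [Finite W] (H : SimpleGraph W) :
    ∃ i, pruneStage H i = basicVertices H := by
  classical
  have := Fintype.ofFinite W
  have h : ∀ v, ∃ i, v ∉ basicVertices H → v ∉ pruneStage H i := by
    intro v
    by_cases hv : v ∈ basicVertices H
    · exact ⟨0, fun h => absurd hv h⟩
    · rw [basicVertices, Set.mem_iInter, not_forall] at hv
      obtain ⟨i, hi⟩ := hv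
      exact ⟨i, fun _ => hi⟩
  choose f hf using h
  refine ⟨Finset.univ.sup f, Set.Subset.antisymm (fun v hv => ?_) (Set.iInter_subset _ _)⟩
  by_contra hv'
  exact hf v hv' (pruneStage_antitone H (Finset.le_sup (Finset.mem_univ v)) hv)

theorem ncard_inter_basicVertices_ne_one {W : Type*} [Finite W] {H : SimpleGraph W} {v : W}
    (hv : v ∈ basicVertices H) : (H.neighborSet v ∩ basicVertices H).ncard ≠ 1 := by
  obtain ⟨i, hi⟩ := exists_pruneStage_eq H
  rw [← hi]
  exact (Set.mem_iInter.1 hv (i + 1)).2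

theorem two_le_ncard_inter_basicVertices {W : Type*} [Finite W] {H : SimpleGraph W}
    (hH : H.Connected) {v w : W} (hv : v ∈ basicVertices H) (hw : w ∈ basicVertices H)
    (hvw : v ≠ w) : 2 ≤ (H.neighborSet v ∩ basicVertices H).ncard := by
  obtain ⟨p, hp⟩ := hH.exists_isPath v w
  have h0 : 0 < (H.neighborSet v ∩ basicVertices H).ncard := by
    rw [Set.ncard_pos]
    have hnil : ¬ p.Nil := fun h => hvw h.eq
    exact ⟨p.snd, p.adj_snd hnil, mem_basicVertices_of_isPath hp hv hw (p.getVert_mem_support 1)⟩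
  have := ncard_inter_basicVertices_ne_one hv
  omega

/-- The round `i` in which `q` falls serves as a rank for inductions from the leaves inwards; at
that moment `q` has exactly one neighbour left. -/
theorem exists_rank {W : Type*} {H : SimpleGraph W} {q : W} (hq : q ∉ basicVertices H) :
    ∃ i, q ∈ pruneStage H i ∧ q ∉ pruneStage H (i + 1) := by
  rw [basicVertices, Set.mem_iInter, not_forall] at hq
  by_contra! h
  obtain ⟨i, hi⟩ := hq
  apply hi
  clear hi
  induction i with
  | zero => trivial
  | succ i ih => exact h i ih

theorem ncard_eq_one_of_rank {W : Type*} {H : SimpleGraph W} {q : W} {i : ℕ}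
    (h : q ∈ pruneStage H i) (h' : q ∉ pruneStage H (i + 1)) :
    (H.neighborSet q ∩ pruneStage H i).ncard = 1 := by
  by_contra hne
  exact h' ⟨h, hne⟩

theorem eq_of_rank {W : Type*} {H : SimpleGraph W} {q r u : W} {i : ℕ}
    (h : q ∈ pruneStage H i) (h' : q ∉ pruneStage H (i + 1)) (hr : H.Adj q r)
    (hri : r ∈ pruneStage H i) (hu : H.Adj q u) (hui : u ∈ pruneStage H i) : u = r := by
  obtain ⟨c, hc⟩ := Set.ncard_eq_one.1 (ncard_eq_one_of_rank h h')
  have h1 : r ∈ H.neighborSet q ∩ pruneStage H i := ⟨hr, hri⟩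
  have h2 : u ∈ H.neighborSet q ∩ pruneStage H i := ⟨hu, hui⟩
  rw [hc] at h1 h2
  exact h2.trans h1.symm

/-- A vertex outside the basic graph has at most one neighbour in the basic graph. -/
theorem eq_of_adj_basicVertices {W : Type*} {H : SimpleGraph W} {q r u : W}
    (hq : q ∉ basicVertices H) (hr : H.Adj q r) (hrB : r ∈ basicVertices H) (hu : H.Adj q u)
    (huB : u ∈ basicVertices H) : u = r := by
  obtain ⟨i, h, h'⟩ := exists_rank hq
  exact eq_of_rank h h' hr (Set.mem_iInter.1 hrB i) hu (Set.mem_iInter.1 huB i)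

theorem reachable_of_closed {W : Type*} {G G' : SimpleGraph W} {w v : W} (h : G.Reachable w v)
    (hG : ∀ p q, G.Reachable w p → G.Adj p q → G'.Adj p q) : G'.Reachable w v := by
  obtain ⟨p⟩ := h
  induction p with
  | nil => exact SimpleGraph.Reachable.refl _
  | cons hadj _ ih =>
    refine (hG _ _ (SimpleGraph.Reachable.refl _) hadj).reachable.trans (ih fun p q h h' => ?_)
    exact hG p q (hadj.reachable.trans h) h'

theorem reachable_deleteEdges_cases {W : Type*} {G : SimpleGraph W} {a b : W} (y z : W)
    (h : G.Reachable a b) :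
    (G.deleteEdges {s(y, z)}).Reachable a b ∨
    ((G.deleteEdges {s(y, z)}).Reachable a y ∧ (G.deleteEdges {s(y, z)}).Reachable z b) ∨
    ((G.deleteEdges {s(y, z)}).Reachable a z ∧ (G.deleteEdges {s(y, z)}).Reachable y b) := by
  obtain ⟨p⟩ := h
  induction p with
  | nil => exact Or.inl (SimpleGraph.Reachable.refl _)
  | @cons u v w hadj p ih =>
    by_cases he : s(u, v) = s(y, z)
    · have hr := SimpleGraph.Reachable.refl (G := G.deleteEdges {s(y, z)})
      rcases Sym2.eq_iff.1 he with ⟨rfl, rfl⟩ | ⟨rfl, rfl⟩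
      · rcases ih with h | ⟨h1, h2⟩ | ⟨h1, h2⟩
        · exact Or.inr (Or.inl ⟨hr _, h⟩)
        · exact Or.inr (Or.inl ⟨hr _, h2⟩)
        · exact Or.inl h2
      · rcases ih with h | ⟨h1, h2⟩ | ⟨h1, h2⟩
        · exact Or.inr (Or.inr ⟨hr _, h⟩)
        · exact Or.inl h2
        · exact Or.inr (Or.inr ⟨hr _, h2⟩)
    · have hadj' : (G.deleteEdges {s(y, z)}).Reachable u v := SimpleGraph.Adj.reachable <| by
        rw [SimpleGraph.deleteEdges_adj]
        exact ⟨hadj, he⟩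
      rcases ih with h | ⟨h1, h2⟩ | ⟨h1, h2⟩
      · exact Or.inl (hadj'.trans h)
      · exact Or.inr (Or.inl ⟨hadj'.trans h1, h2⟩)
      · exact Or.inr (Or.inr ⟨hadj'.trans h1, h2⟩)

/-- An edge on a cycle still lies on a cycle after deleting a bridge. -/
theorem IsCycleEdge.reachable_of_isCutEdge {W : Type*} {H : SimpleGraph W} {a b y z : W}
    (hab : IsCycleEdge H a b) (hyz : IsCutEdge H y z) :
    (H.deleteEdges {s(y, z), s(a, b)}).Reachable a b := by
  have hE : H.deleteEdges {s(y, z), s(a, b)}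
      = (H.deleteEdges {s(a, b)}).deleteEdges {s(y, z)} := by
    rw [SimpleGraph.deleteEdges_deleteEdges, Set.union_comm]
    rfl
  have hle : H.deleteEdges {s(y, z), s(a, b)} ≤ H.deleteEdges {s(y, z)} :=
    H.deleteEdges_anti (by simp)
  have habne : s(a, b) ≠ s(y, z) := by
    intro h
    rcases Sym2.eq_iff.1 h with ⟨rfl, rfl⟩ | ⟨rfl, rfl⟩
    · exact hyz.not_isCycleEdge hab
    · exact hyz.not_isCycleEdge hab.symm
  have hab' : (H.deleteEdges {s(y, z)}).Reachable a b := SimpleGraph.Adj.reachable <| by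
    rw [SimpleGraph.deleteEdges_adj]
    exact ⟨hab.1, habne⟩
  -- If the detour from `a` to `b` crossed the bridge, its two remaining pieces and the edge `a b`
  -- would join `y` to `z` without it.
  rcases reachable_deleteEdges_cases y z hab.2 with h | ⟨h1, h2⟩ | ⟨h1, h2⟩
  · rwa [hE]
  · rw [← hE] at h1 h2
    exact absurd (((h1.mono hle).symm.trans hab').trans (h2.mono hle).symm) hyz.2
  · rw [← hE] at h1 h2
    exact absurd (((h2.mono hle).trans hab'.symm).trans (h1.mono hle)) hyz.2

/-- A vertex of the basic graph at which a tree is attached. -/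
def IsRoot {W : Type*} (H : SimpleGraph W) (r : W) : Prop :=
  r ∈ basicVertices H ∧ ∃ w, w ∉ basicVertices H ∧ H.Adj r w

theorem isRoot_of_ncard_lt {W : Type*} {H : SimpleGraph W} {r : W} (hr : r ∈ basicVertices H)
    (h : (H.neighborSet r ∩ basicVertices H).ncard < (H.neighborSet r).ncard) : IsRoot H r := by
  refine ⟨hr, ?_⟩
  by_contra! hcon
  refine h.ne (congrArg _ (Set.inter_eq_left.2 fun w hw => ?_))
  by_contra hw'
  exact hcon w hw' hw

theorem exists_isRoot {W : Type*} {H : SimpleGraph W} (hH : H.Connected) {p b : W} (hp : p ∉ basicVertices H)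
    (hb : b ∈ basicVertices H) : ∃ r, IsRoot H r := by
  obtain ⟨P⟩ := hH.preconnected b p
  obtain ⟨d, _, h1, h2⟩ := P.exists_boundary_dart (basicVertices H) hb hp
  exact ⟨d.fst, h1, d.snd, h2, d.adj⟩

/-! ### Hanging trees and their roots against cycle vertices. -/

section Weight

variable {W : Type*} [Fintype W] {α : ℝ} {H : SimpleGraph W} {x : W → ℝ}

theorem IsCycleEdge.two_le_ncard {u v : W} (h : IsCycleEdge H u v) :
    2 ≤ (H.neighborSet u).ncard := by
  obtain ⟨v', hne, h'⟩ := h.exists_ne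
  rw [← Set.ncard_pair hne.symm]
  refine Set.ncard_le_ncard ?_
  rintro z (rfl | rfl)
  · exact h.1
  · exact h'.1

/-- Vertices outside the basic graph have smaller weight than vertices on cycles. -/
theorem IsExtremalWeight.lt_of_rank (hα : 0 ≤ α) (hx : IsExtremalWeight α H x) (hH : H.Connected)
    {q : W} {i : ℕ} (h : q ∈ pruneStage H i) (h' : q ∉ pruneStage H (i + 1)) {u v : W}
    (huv : IsCycleEdge H u v) (hqv : ¬ H.Adj q v) : x q < x u := by
  induction i generalizing q u v with
  | zero =>
    apply hx.lt_of_ncard_lt hα hH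
    have h1 : (H.neighborSet q).ncard = 1 := by
      have := ncard_eq_one_of_rank h h'
      rwa [pruneStage, Set.inter_univ] at this
    have := huv.two_le_ncard
    omega
  | succ i ih =>
    have hqB : q ∉ basicVertices H := fun hB => h' (Set.mem_iInter.1 hB _)
    have hB : ∀ {z}, z ∈ basicVertices H → z ∈ pruneStage H i := fun hz => Set.mem_iInter.1 hz i
    -- If no neighbour of `q` fell in the previous round, `q` would already have been pendant then.
    -- The bridge from such a `q'` to `q` is switched against the cycle edge, starting from `x q' <
    -- x v`.
    obtain ⟨q', hq', hqi, hqi'⟩ : ∃ q', H.Adj q q' ∧ q' ∈ pruneStage H i ∧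
        q' ∉ pruneStage H (i + 1) := by
      by_contra! hcon
      refine h.2 ?_
      rw [← ncard_eq_one_of_rank h h']
      congr 1
      ext z
      exact ⟨fun hz => ⟨hz.1, hcon z hz.1 hz.2⟩, fun hz => ⟨hz.1, hz.2.1⟩⟩
    have hq'u : ¬ H.Adj q' u := by
      intro hadj
      have := eq_of_rank hqi hqi' hq'.symm h.1 hadj (hB huv.left_mem)
      exact hqB (this ▸ huv.left_mem)
    refine hx.lt_of_switch hH hq'.symm huv.symm.1 hq'u hqv ?_ ?_ (Or.inl ?_)
      (ih hqi hqi' huv.symm hq'u)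
    · rintro rfl
      exact hqi' (Set.mem_iInter.1 huv.left_mem _)
    · rintro rfl
      exact hqB huv.right_mem
    · exact huv.symm.reachable_of_isCutEdge (isCutEdge_of_notMem hq' hqB).symm

theorem IsExtremalWeight.lt_of_notMem (hα : 0 ≤ α) (hx : IsExtremalWeight α H x)
    (hH : H.Connected) {q : W} (hq : q ∉ basicVertices H) {u v : W}
    (huv : IsCycleEdge H u v) (hqv : ¬ H.Adj q v) : x q < x u := by
  obtain ⟨i, h, h'⟩ := exists_rank hq
  exact hx.lt_of_rank hα hH h h' huv hqv

/-- A neighbour `w` of `r` outside the basic graph has no other basic neighbour, so `x w < x v`.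
Switching the bridge `w r` against `v u` transfers the inequality to `r` and `u`. -/
theorem IsExtremalWeight.lt_of_isRoot (hα : 0 ≤ α) (hx : IsExtremalWeight α H x)
    (hH : H.Connected) {r : W} (hr : IsRoot H r) {u v : W} (huv : IsCycleEdge H u v)
    (hur : u ≠ r) (hvr : v ≠ r) (hrv : ¬ H.Adj r v) : x r < x u := by
  obtain ⟨hrB, w, hw, hrw⟩ := hr
  have hwu : ¬ H.Adj w u := fun h =>
    hur (eq_of_adj_basicVertices hw hrw.symm hrB h huv.left_mem)
  refine hx.lt_of_switch hH hrw.symm huv.symm.1 hwu hrv ?_ hvr.symm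
    (Or.inl (huv.symm.reachable_of_isCutEdge (isCutEdge_of_notMem hrw.symm hw)))
    (hx.lt_of_notMem hα hH hw huv.symm hwu)
  rintro rfl
  exact hw huv.left_mem

theorem IsRoot.ncard_lt {r : W} (hr : IsRoot H r) :
    (H.neighborSet r ∩ basicVertices H).ncard < (H.neighborSet r).ncard := by
  obtain ⟨_, w, hw, hrw⟩ := hr
  refine Set.ncard_lt_ncard ⟨Set.inter_subset_left, fun h => hw (h hrw).2⟩

/-- If a tree is attached at `r` and the weight of `u` is not smaller, then a tree is attached at
`u` as well, provided that `u` has degree two in the basic graph. -/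
theorem IsExtremalWeight.isRoot_of_lt (hα : 0 ≤ α) (hx : IsExtremalWeight α H x)
    (hH : H.Connected) {r u : W} (hd : 3 ≤ (H.neighborSet r).ncard)
    (hu : u ∈ basicVertices H) (hu2 : (H.neighborSet u ∩ basicVertices H).ncard = 2)
    (hlt : x r < x u) : IsRoot H u := by
  refine isRoot_of_ncard_lt hu ?_
  by_contra! h
  exact absurd (hx.lt_of_ncard_lt hα hH (u := r) (v := u) (by omega)) hlt.not_gt

theorem IsRoot.three_le {r w : W} (hH : H.Connected) (hr : IsRoot H r)
    (hw : w ∈ basicVertices H) (hrw : r ≠ w) : 3 ≤ (H.neighborSet r).ncard := by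
  have := hr.ncard_lt
  have := two_le_ncard_inter_basicVertices hH hr.1 hw hrw
  omega

end Weight

/-! ### The two sides of a bridge. -/

/-- The vertices that can be reached from `y` without using the edge `y z`. -/
def side {W : Type*} (H : SimpleGraph W) (y z : W) : Set W :=
  {v | (H.deleteEdges {s(y, z)}).Reachable y v}

section Side

variable {W : Type*} {H : SimpleGraph W} {u v w y z a b p q : W}

theorem self_mem_side : y ∈ side H y z := SimpleGraph.Reachable.refl _

theorem mem_side_or (hH : H.Connected) (y z v : W) : v ∈ side H y z ∨ v ∈ side H z y := by
  rcases reachable_deleteEdges_cases y z (hH.preconnected y v) with h | ⟨_, h⟩ | ⟨_, h⟩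
  · exact Or.inl h
  · refine Or.inr ?_
    rw [side, Sym2.eq_swap]
    exact h
  · exact Or.inl h

theorem IsCutEdge.notMem_side (h : IsCutEdge H y z) (hv : v ∈ side H y z) : v ∉ side H z y := by
  intro hv'
  rw [side, Sym2.eq_swap] at hv'
  exact h.2 (SimpleGraph.Reachable.trans hv (SimpleGraph.Reachable.symm hv'))

theorem mem_side_of_adj (hv : v ∈ side H y z) (hvw : H.Adj v w) (hne : s(v, w) ≠ s(y, z)) :
    w ∈ side H y z :=
  SimpleGraph.Reachable.trans hv <| SimpleGraph.Adj.reachable <| by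
    rw [SimpleGraph.deleteEdges_adj]
    exact ⟨hvw, hne⟩

theorem mem_side_of_adj_left (hyw : H.Adj y w) (hne : w ≠ z) : w ∈ side H y z :=
  mem_side_of_adj self_mem_side hyw fun h => hne (Sym2.congr_right.1 h)

/-- From `w` one steps to `v` and stays in a component that does not contain `w`, so `w u` is never
used. This nests the sides of consecutive bridges. -/
theorem IsCutEdge.side_subset (h : IsCutEdge H v w) (hne : v ≠ u) : side H v w ⊆ side H w u := by
  intro c hc
  refine SimpleGraph.Reachable.trans (v := v) ?_ (reachable_of_closed hc fun p q hp hpq => ?_)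
  · exact mem_side_of_adj_left h.1.symm hne
  · have hq : q ∈ side H v w := SimpleGraph.Reachable.trans hp hpq.reachable
    rw [SimpleGraph.deleteEdges_adj] at hpq ⊢
    refine ⟨hpq.1, fun he => ?_⟩
    rcases Sym2.eq_iff.1 he with ⟨rfl, _⟩ | ⟨_, rfl⟩
    · exact h.notMem_side hp self_mem_side
    · exact h.notMem_side hq self_mem_side

theorem IsCutEdge.not_adj (h : IsCutEdge H y z) (hp : p ∈ side H z y) (ha : a ∈ side H y z)
    (hay : a ≠ y) : ¬ H.Adj p a := by
  intro hpa
  refine h.notMem_side ha (mem_side_of_adj hp hpa fun he => ?_)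
  rcases Sym2.eq_iff.1 he with ⟨_, rfl⟩ | ⟨_, rfl⟩
  · exact hay rfl
  · exact h.notMem_side ha self_mem_side

theorem IsCutEdge.ne_of_mem_side (h : IsCutEdge H y z) (hp : p ∈ side H z y)
    (ha : a ∈ side H y z) : p ≠ a := by
  rintro rfl
  exact h.notMem_side ha hp

theorem IsCycleEdge.mem_side (hab : IsCycleEdge H a b) (h : IsCutEdge H y z)
    (ha : a ∈ side H y z) : b ∈ side H y z := by
  refine mem_side_of_adj ha hab.1 fun he => h.not_isCycleEdge ?_
  rcases Sym2.eq_iff.1 he with ⟨rfl, rfl⟩ | ⟨rfl, rfl⟩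
  · exact hab
  · exact hab.symm

theorem IsCycleEdge.reachable_of_mem_side (hab : IsCycleEdge H a b) (h : IsCutEdge H y z)
    (ha : a ∈ side H y z) (hp : p ∈ side H z y) :
    (H.deleteEdges {s(p, q), s(a, b)}).Reachable a b := by
  refine reachable_of_closed (hab.reachable_of_isCutEdge h) fun c d hc hcd => ?_
  have hle : H.deleteEdges {s(y, z), s(a, b)} ≤ H.deleteEdges {s(y, z)} :=
    H.deleteEdges_anti (by simp)
  have hcs : c ∈ side H y z := SimpleGraph.Reachable.trans ha (hc.mono hle)
  have hds : d ∈ side H y z := SimpleGraph.Reachable.trans hcs (hcd.reachable.mono hle)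
  rw [SimpleGraph.deleteEdges_adj] at hcd ⊢
  refine ⟨hcd.1, fun he => ?_⟩
  rcases he with he | he
  · rcases Sym2.eq_iff.1 he with ⟨rfl, _⟩ | ⟨_, rfl⟩
    · exact h.notMem_side hcs hp
    · exact h.notMem_side hds hp
  · exact hcd.2 (Or.inr he)

/-- Both sides of a bridge of the basic graph contain an edge on a cycle. -/
theorem IsCutEdge.exists_isCycleEdge [Finite W] (hH : H.Connected) (h : IsCutEdge H y z)
    (hy : y ∈ basicVertices H) (hz : z ∈ basicVertices H) :
    ∃ a b, IsCycleEdge H a b ∧ a ∈ side H y z ∧ b ∈ side H y z ∧ a ≠ y ∧ b ≠ y := by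
  induction hn : (side H y z).ncard using Nat.strong_induction_on generalizing y z with
  | _ n ih =>
    obtain ⟨w, ⟨hyw, hw⟩, hwz⟩ : ∃ w ∈ H.neighborSet y ∩ basicVertices H, w ≠ z :=
      Set.exists_ne_of_one_lt_ncard (two_le_ncard_inter_basicVertices hH hy hz h.1.ne) z
    have hwS : w ∈ side H y z := mem_side_of_adj_left hyw hwz
    -- If `y w` lies on a cycle, the next cycle edge at `w` avoids `y`. If it is a bridge, the side
    -- of `w` away from `y` is strictly smaller.
    rcases isCycleEdge_or_isCutEdge hyw with hc | hc
    · obtain ⟨w', hne, hc'⟩ := hc.symm.exists_ne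
      exact ⟨w, w', hc', hwS, hc'.mem_side h hwS, hyw.ne.symm, hne⟩
    · have hsub : side H w y ⊆ side H y z := hc.symm.side_subset hwz
      have hyn : y ∉ side H w y := hc.notMem_side self_mem_side
      have hlt : (side H w y).ncard < n := by
        rw [← hn]
        exact Set.ncard_lt_ncard ⟨hsub, fun h' => hyn (h' self_mem_side)⟩
      obtain ⟨a, b, hab, ha, hb, _, _⟩ := ih _ hlt hc.symm hw hy rfl
      refine ⟨a, b, hab, hsub ha, hsub hb, ?_, ?_⟩
      · rintro rfl; exact hyn ha
      · rintro rfl; exact hyn hb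

end Side

/-! ### Comparing weights across a bridge. -/

section Weight

variable {W : Type*} [Fintype W] {α : ℝ} {H : SimpleGraph W} {x : W → ℝ} {y z a b p q : W}

/-- The comparison with `a` and `b` spreads along walks on the `z`-side: each edge there is switched
against `a b` in both orientations. As `a` and `b` avoid `y`, the new edges are absent beforehand,
and the cycle through `a b` keeps the graph connected. -/
theorem IsExtremalWeight.lt_of_mem_side (hx : IsExtremalWeight α H x) (hH : H.Connected)
    (h : IsCutEdge H y z) (hab : IsCycleEdge H a b) (ha : a ∈ side H y z) (hay : a ≠ y)
    (hby : b ≠ y) (hp : p ∈ side H z y) (hpa : x p < x a) (hpb : x p < x b)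
    (hq : q ∈ side H z y) : x q < x a ∧ x q < x b := by
  have hb := hab.mem_side h ha
  have hpq : (H.deleteEdges {s(z, y)}).Reachable p q :=
    SimpleGraph.Reachable.trans (SimpleGraph.Reachable.symm hp) hq
  clear hq
  obtain ⟨P⟩ := hpq
  induction P with
  | nil => exact ⟨hpa, hpb⟩
  | @cons c d e hadj _ ih =>
    have hd : d ∈ side H z y := SimpleGraph.Reachable.trans hp hadj.reachable
    have hcd : H.Adj c d := SimpleGraph.deleteEdges_le _ hadj
    refine ih hd ?_ ?_
    · exact hx.lt_of_switch hH hcd hab.symm.1 (h.not_adj hp ha hay) (h.not_adj hd hb hby)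
        (h.ne_of_mem_side hp ha) (h.ne_of_mem_side hd hb)
        (Or.inl (hab.symm.reachable_of_mem_side h hb hp)) hpb
    · exact hx.lt_of_switch hH hcd hab.1 (h.not_adj hp hb hby) (h.not_adj hd ha hay)
        (h.ne_of_mem_side hp hb) (h.ne_of_mem_side hd ha)
        (Or.inl (hab.reachable_of_mem_side h ha hp)) hpa

theorem IsExtremalWeight.gt_of_mem_side (hx : IsExtremalWeight α H x) (hH : H.Connected)
    (h : IsCutEdge H y z) (hab : IsCycleEdge H a b) (ha : a ∈ side H y z) (hay : a ≠ y)
    (hby : b ≠ y) (hp : p ∈ side H z y) (hpa : x a < x p) (hpb : x b < x p)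
    (hq : q ∈ side H z y) : x a < x q ∧ x b < x q := by
  have hb := hab.mem_side h ha
  have hpq : (H.deleteEdges {s(z, y)}).Reachable p q :=
    SimpleGraph.Reachable.trans (SimpleGraph.Reachable.symm hp) hq
  clear hq
  obtain ⟨P⟩ := hpq
  induction P with
  | nil => exact ⟨hpa, hpb⟩
  | @cons c d e hadj _ ih =>
    have hd : d ∈ side H z y := SimpleGraph.Reachable.trans hp hadj.reachable
    have hcd : H.Adj c d := SimpleGraph.deleteEdges_le _ hadj
    refine ih hd ?_ ?_
    · refine hx.lt_of_switch hH hab.symm.1 hcd (fun h' => h.not_adj hd hb hby h'.symm)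
        (fun h' => h.not_adj hp ha hay h'.symm)
        (h.ne_of_mem_side hd hb).symm (h.ne_of_mem_side hp ha).symm (Or.inr (Or.inl ?_)) hpb
      rw [Set.pair_comm]
      exact hab.symm.reachable_of_mem_side h hb hp
    · refine hx.lt_of_switch hH hab.1 hcd (fun h' => h.not_adj hd ha hay h'.symm)
        (fun h' => h.not_adj hp hb hby h'.symm)
        (h.ne_of_mem_side hd ha).symm (h.ne_of_mem_side hp hb).symm (Or.inr (Or.inl ?_)) hpa
      rw [Set.pair_comm]
      exact hab.reachable_of_mem_side h ha hp

/-- If a tree hangs on the `z`-side of a bridge `y z`, then all weights on that side are smaller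
than those of the cycles on the `y`-side. -/
theorem IsExtremalWeight.lt_of_notMem_of_mem_side (hα : 0 ≤ α) (hx : IsExtremalWeight α H x)
    (hH : H.Connected) (h : IsCutEdge H y z) (hab : IsCycleEdge H a b) (ha : a ∈ side H y z)
    (hay : a ≠ y) (hby : b ≠ y) (hp : p ∈ side H z y) (hpB : p ∉ basicVertices H)
    (hq : q ∈ side H z y) : x q < x a := by
  have hb := hab.mem_side h ha
  exact (hx.lt_of_mem_side hH h hab ha hay hby hp
    (hx.lt_of_notMem hα hH hpB hab (h.not_adj hp hb hby))
    (hx.lt_of_notMem hα hH hpB hab.symm (h.not_adj hp ha hay)) hq).1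

end Weight

theorem eq_or_eq_of_ncard_eq_two {W : Type*} {S : Set W} (hS : S.ncard = 2) {a b c : W}
    (ha : a ∈ S) (hb : b ∈ S) (hab : a ≠ b) (hc : c ∈ S) : c = a ∨ c = b := by
  obtain ⟨p, q, hpq, rfl⟩ := Set.ncard_eq_two.1 hS
  simp only [Set.mem_insert_iff, Set.mem_singleton_iff] at ha hb hc
  grind

/-! ### Excluded configurations. -/

section Cases

variable {W : Type*} [Fintype W] {α : ℝ} {H : SimpleGraph W} {x : W → ℝ}

/-- Two adjacent vertices of degree two in the basic graph do not lie on a cycle of length at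
least four. -/
theorem IsExtremalWeight.false_of_four_path (hα : 0 ≤ α) (hx : IsExtremalWeight α H x)
    (hH : H.Connected) {u₁ u₂ u₃ u₄ r : W} (h₁₂ : IsCycleEdge H u₁ u₂) (h₂₃ : IsCycleEdge H u₂ u₃)
    (h₃₄ : IsCycleEdge H u₃ u₄) (h₁₃ : u₁ ≠ u₃) (h₂₄ : u₂ ≠ u₄) (h₁₄ : u₁ ≠ u₄)
    (hd₂ : (H.neighborSet u₂ ∩ basicVertices H).ncard = 2)
    (hd₃ : (H.neighborSet u₃ ∩ basicVertices H).ncard = 2) (hr : IsRoot H r) : False := by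
  have m₁ := h₁₂.left_mem
  have m₂ := h₁₂.right_mem
  have m₃ := h₃₄.left_mem
  have m₄ := h₃₄.right_mem
  have n₂ : ∀ w ∈ basicVertices H, H.Adj u₂ w → w = u₁ ∨ w = u₃ := fun w hw h =>
    eq_or_eq_of_ncard_eq_two hd₂ ⟨h₁₂.1.symm, m₁⟩ ⟨h₂₃.1, m₃⟩ h₁₃ ⟨h, hw⟩
  have n₃ : ∀ w ∈ basicVertices H, H.Adj u₃ w → w = u₂ ∨ w = u₄ := fun w hw h =>
    eq_or_eq_of_ncard_eq_two hd₃ ⟨h₂₃.1.symm, m₂⟩ ⟨h₃₄.1, m₄⟩ h₂₄ ⟨h, hw⟩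
  have a₂₄ : ¬ H.Adj u₂ u₄ := fun h => by
    rcases n₂ _ m₄ h with rfl | rfl
    · exact h₁₄ rfl
    · exact h₃₄.1.ne rfl
  have a₃₁ : ¬ H.Adj u₃ u₁ := fun h => by
    rcases n₃ _ m₁ h with rfl | rfl
    · exact h₁₂.1.ne rfl
    · exact h₁₄ rfl
  have lt₂₃ : IsRoot H u₂ → x u₂ < x u₃ := fun h =>
    hx.lt_of_isRoot hα hH h h₃₄ h₂₃.1.ne.symm h₂₄.symm a₂₄
  have lt₃₂ : IsRoot H u₃ → x u₃ < x u₂ := fun h =>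
    hx.lt_of_isRoot hα hH h h₁₂.symm h₂₃.1.ne h₁₃ a₃₁
  -- If one of `u₂`, `u₃` is a root, the other is heavier, hence also a root, hence lighter.
  have key₂ : ¬ IsRoot H u₂ := fun h =>
    (lt₂₃ h).not_gt (lt₃₂ (hx.isRoot_of_lt hα hH (h.three_le hH m₃ h₂₃.1.ne) m₃ hd₃ (lt₂₃ h)))
  have key₃ : ¬ IsRoot H u₃ := fun h =>
    (lt₃₂ h).not_gt (lt₂₃ (hx.isRoot_of_lt hα hH (h.three_le hH m₂ h₂₃.1.ne.symm) m₂ hd₂ (lt₃₂ h)))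
  have hr₂ : r ≠ u₂ := by rintro rfl; exact key₂ hr
  have hr₃ : r ≠ u₃ := by rintro rfl; exact key₃ hr
  have hd := hr.three_le hH m₂ hr₂
  by_cases hr₄ : r = u₄
  · subst hr₄
    exact key₃ (hx.isRoot_of_lt hα hH hd m₃ hd₃
      (hx.lt_of_isRoot hα hH hr h₂₃.symm hr₃.symm hr₂.symm fun h => a₂₄ h.symm))
  · refine key₂ (hx.isRoot_of_lt hα hH hd m₂ hd₂
      (hx.lt_of_isRoot hα hH hr h₂₃ hr₂.symm hr₃.symm fun h => ?_))
    rcases n₃ r hr.1 h.symm with h | h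
    · exact hr₂ h
    · exact hr₄ h

/-- No tree hangs between two consecutive bridges of the basic graph. -/
theorem IsExtremalWeight.false_of_mem_side_of_mem_side (hα : 0 ≤ α) (hx : IsExtremalWeight α H x)
    (hH : H.Connected) {u₁ u₂ u₃ p : W} (h₁₂ : IsCutEdge H u₁ u₂) (h₂₃ : IsCutEdge H u₂ u₃)
    (h₁₃ : u₁ ≠ u₃) (m₁ : u₁ ∈ basicVertices H) (m₂ : u₂ ∈ basicVertices H)
    (m₃ : u₃ ∈ basicVertices H) (hp : p ∉ basicVertices H) (hp₁ : p ∈ side H u₂ u₁)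
    (hp₃ : p ∈ side H u₂ u₃) : False := by
  obtain ⟨a, b, hab, ha, -, ha₁, hb₁⟩ := h₁₂.exists_isCycleEdge hH m₁ m₂
  obtain ⟨a', b', hab', ha', -, ha₃, hb₃⟩ := h₂₃.symm.exists_isCycleEdge hH m₃ m₂
  -- Seen from either bridge, `p` lies on the same side as the cycle beyond the other bridge, so
  -- each of the two cycles is lighter than the other.
  have l₁ := hx.lt_of_notMem_of_mem_side hα hH h₁₂ hab ha ha₁ hb₁ hp₁ hp
    (h₂₃.symm.side_subset h₁₃.symm ha')
  have l₂ := hx.lt_of_notMem_of_mem_side hα hH h₂₃.symm hab' ha' ha₃ hb₃ hp₃ hp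
    (h₁₂.side_subset h₁₃ ha)
  exact l₁.not_gt l₂

/-- No tree hangs beyond an end of an internal path of length at least two consisting of
bridges. -/
theorem IsExtremalWeight.false_of_mem_side_end (hα : 0 ≤ α) (hx : IsExtremalWeight α H x)
    (hH : H.Connected) {u₁ u₂ u₃ p : W} (h₁₂ : IsCutEdge H u₁ u₂) (h₂₃ : IsCutEdge H u₂ u₃)
    (h₁₃ : u₁ ≠ u₃) (m₁ : u₁ ∈ basicVertices H) (m₂ : u₂ ∈ basicVertices H)
    (m₃ : u₃ ∈ basicVertices H) (hd₁ : 3 ≤ (H.neighborSet u₁ ∩ basicVertices H).ncard)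
    (hd₂ : (H.neighborSet u₂ ∩ basicVertices H).ncard = 2)
    (hp : p ∉ basicVertices H) (hp₁ : p ∈ side H u₁ u₂) : False := by
  obtain ⟨a', b', hab', ha', hb', ha₃, hb₃⟩ := h₂₃.symm.exists_isCycleEdge hH m₃ m₂
  have s₁ : side H u₁ u₂ ⊆ side H u₂ u₃ := h₁₂.side_subset h₁₃
  have s₃ : side H u₃ u₂ ⊆ side H u₂ u₁ := h₂₃.symm.side_subset h₁₃.symm
  have low : ∀ q ∈ side H u₂ u₃, x q < x a' := fun q hq =>
    hx.lt_of_notMem_of_mem_side hα hH h₂₃.symm hab' ha' ha₃ hb₃ (s₁ hp₁) hp hq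
  have noroot : ¬ IsRoot H u₂ := by
    rintro ⟨-, w, hw, hadj⟩
    have hw₁ : w ∈ side H u₂ u₁ := mem_side_of_adj_left hadj (by rintro rfl; exact hw m₁)
    have hw₃ : w ∈ side H u₂ u₃ := mem_side_of_adj_left hadj (by rintro rfl; exact hw m₃)
    exact hx.false_of_mem_side_of_mem_side hα hH h₁₂ h₂₃ h₁₃ m₁ m₂ m₃ hw hw₁ hw₃
  have lt₂₁ : x u₂ < x u₁ := by
    apply hx.lt_of_ncard_lt hα hH
    have h1 : (H.neighborSet u₁ ∩ basicVertices H).ncard ≤ (H.neighborSet u₁).ncard :=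
      Set.ncard_le_ncard Set.inter_subset_left
    have h2 : ¬ (H.neighborSet u₂ ∩ basicVertices H).ncard < (H.neighborSet u₂).ncard :=
      fun h => noroot (isRoot_of_ncard_lt m₂ h)
    omega
  have a₃₁ : ¬ H.Adj u₃ u₁ :=
    fun h => h₁₂.symm.not_adj self_mem_side (s₃ self_mem_side) h₂₃.1.ne.symm h.symm
  -- Switch `u₂ u₃` against `u₁ w`; the edge `u₂ u₁` keeps the graph connected.
  have lt₃ : ∀ w, H.Adj u₁ w → w ≠ u₂ → x u₃ < x w := by
    intro w hw hne
    have hws : w ∈ side H u₁ u₂ := mem_side_of_adj_left hw hne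
    exact hx.lt_of_switch hH h₂₃.1 hw (h₁₂.not_adj self_mem_side hws hw.ne.symm) a₃₁
      hne.symm h₁₃.symm (Or.inr (Or.inr h₁₂.1.symm)) lt₂₁
  -- A cycle through `u₁ w` has a second edge `w w'` avoiding `u₁`. Since `a'` is heavier than both
  -- its ends, so is everything on the far side of `u₁ u₂`, including `u₃`, against `lt₃`.
  have nocycle : ∀ w, IsCycleEdge H u₁ w → w ≠ u₂ → False := by
    intro w hw hne
    obtain ⟨w', hne', hw'⟩ := hw.symm.exists_ne
    have hws : w ∈ side H u₁ u₂ := mem_side_of_adj_left hw.1 hne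
    have hws' : w' ∈ side H u₁ u₂ := hw'.mem_side h₁₂ hws
    exact (lt₃ w hw.1 hne).not_gt (hx.gt_of_mem_side hH h₁₂ hw' hws hw.1.ne.symm hne' (s₃ ha')
      (low _ (s₁ hws)) (low _ (s₁ hws')) (s₃ self_mem_side)).1
  have nocut : ∀ w ∈ basicVertices H, IsCutEdge H u₁ w → w ≠ u₂ → p ∉ side H u₁ w := by
    intro w hwB hw hne hpw
    obtain ⟨a, b, hab, ha, -, haw, hbw⟩ := hw.symm.exists_isCycleEdge hH hwB m₁
    have h1 := hx.lt_of_notMem_of_mem_side hα hH hw.symm hab ha haw hbw hpw hp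
      (h₁₂.symm.side_subset hne.symm (s₃ ha'))
    exact h1.not_gt (low a (s₁ (hw.symm.side_subset hne ha)))
  -- Besides `u₂` there are two basic neighbours of `u₁`, both across bridges. By `nocut` the vertex
  -- `p` would have to lie beyond each of them, which is impossible.
  obtain ⟨w₁, ⟨hw₁, hwB₁⟩, hne₁⟩ :
      ∃ w ∈ H.neighborSet u₁ ∩ basicVertices H, w ≠ u₂ :=
    Set.exists_ne_of_one_lt_ncard (by omega) u₂
  obtain ⟨w₂, ⟨⟨hw₂, hwB₂⟩, hne₂⟩, hne₁₂⟩ :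
      ∃ w ∈ (H.neighborSet u₁ ∩ basicVertices H) \ {u₂}, w ≠ w₁ := by
    refine Set.exists_ne_of_one_lt_ncard ?_ w₁
    have := Set.ncard_sdiff_singleton_add_one
      (show u₂ ∈ H.neighborSet u₁ ∩ basicVertices H from ⟨h₁₂.1, m₂⟩)
    omega
  have c₁ := (isCycleEdge_or_isCutEdge hw₁).resolve_left fun h => nocycle _ h hne₁
  have c₂ := (isCycleEdge_or_isCutEdge hw₂).resolve_left fun h => nocycle _ h hne₂
  have p₁ := (mem_side_or hH u₁ w₁ p).resolve_left (nocut _ hwB₁ c₁ hne₁)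
  exact nocut _ hwB₂ c₂ hne₂ (c₁.symm.side_subset hne₁₂.symm p₁)

/-- In every case `u₂` is forced to be a root as well. If `r` is adjacent to both `u₁` and `u₃`, the
resulting four-cycle makes `u₂` both heavier and lighter than `u₃`. Otherwise `r` is lighter than
`u₂`, so `r` lies on no cycle, and a cycle beyond a bridge at `r` is both heavier and lighter than
`u₂`. -/
theorem IsExtremalWeight.false_of_isRoot_of_ne (hα : 0 ≤ α) (hx : IsExtremalWeight α H x)
    (hH : H.Connected) {u₁ u₂ u₃ r : W} (h₁₂ : IsCycleEdge H u₁ u₂) (h₂₃ : IsCycleEdge H u₂ u₃)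
    (h₁₃ : u₁ ≠ u₃) (a₁₃ : ¬ H.Adj u₁ u₃)
    (hd₂ : (H.neighborSet u₂ ∩ basicVertices H).ncard = 2)
    (hd₃ : 3 ≤ (H.neighborSet u₃).ncard) (hr : IsRoot H r) (hr₂ : r ≠ u₂) : False := by
  have m₁ := h₁₂.left_mem
  have m₂ := h₁₂.right_mem
  have m₃ := h₂₃.right_mem
  have n₂ : ∀ w ∈ basicVertices H, H.Adj u₂ w → w = u₁ ∨ w = u₃ := fun w hw h =>
    eq_or_eq_of_ncard_eq_two hd₂ ⟨h₁₂.1.symm, m₁⟩ ⟨h₂₃.1, m₃⟩ h₁₃ ⟨h, hw⟩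
  by_cases hadj : H.Adj r u₁ ∧ H.Adj r u₃
  · obtain ⟨hr₁, hr₃⟩ := hadj
    have ar₂ : ¬ H.Adj r u₂ := fun h => by
      rcases n₂ r hr.1 h.symm with rfl | rfl
      · exact hr₁.ne rfl
      · exact hr₃.ne rfl
    have l₁ : x r < x u₁ := hx.lt_of_isRoot hα hH hr h₁₂ hr₁.ne.symm hr₂.symm ar₂
    have l₂ : x u₃ < x u₂ :=
      hx.lt_of_switch hH hr₃ h₁₂.1 ar₂ (fun h => a₁₃ h.symm) hr₂ h₁₃.symm
        (Or.inr (Or.inr hr₁)) l₁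
    have hroot := hx.isRoot_of_lt hα hH hd₃ m₂ hd₂ l₂
    have hcyc : IsCycleEdge H u₃ r := by
      refine ⟨hr₃.symm, ?_⟩
      have step : ∀ {c d}, H.Adj c d → s(c, d) ≠ s(u₃, r) →
          (H.deleteEdges {s(u₃, r)}).Reachable c d := fun h h' =>
        SimpleGraph.Adj.reachable (by rw [SimpleGraph.deleteEdges_adj]; exact ⟨h, h'⟩)
      refine ((step h₂₃.1.symm ?_).trans (step h₁₂.1.symm ?_)).trans (step hr₁.symm ?_)
      · exact fun h => hr₂ (Sym2.congr_right.1 h).symm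
      · intro h; rcases Sym2.eq_iff.1 h with h | h
        · exact h₂₃.1.ne h.1
        · exact hr₂ h.1.symm
      · intro h; rcases Sym2.eq_iff.1 h with h | h
        · exact h₁₃ h.1
        · exact hr₁.ne h.1.symm
    exact l₂.not_gt (hx.lt_of_isRoot hα hH hroot hcyc h₂₃.1.ne.symm hr₂ fun h => ar₂ h.symm)
  · obtain ⟨v, hv₂, hv, arv, hrv⟩ : ∃ v, IsCycleEdge H u₂ v ∧ (v = u₁ ∨ v = u₃) ∧
        ¬ H.Adj r v ∧ v ≠ r := by
      by_cases e₁ : r = u₁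
      · subst e₁
        exact ⟨u₃, h₂₃, Or.inr rfl, a₁₃, h₁₃.symm⟩
      by_cases e₃ : r = u₃
      · subst e₃
        exact ⟨u₁, h₁₂.symm, Or.inl rfl, fun h => a₁₃ h.symm, h₁₃⟩
      by_cases h : H.Adj r u₁
      · exact ⟨u₃, h₂₃, Or.inr rfl, fun h' => hadj ⟨h, h'⟩, fun h' => e₃ h'.symm⟩
      · exact ⟨u₁, h₁₂.symm, Or.inl rfl, h, fun h' => e₁ h'.symm⟩
    have l₁ : x r < x u₂ := hx.lt_of_isRoot hα hH hr hv₂ hr₂.symm hrv arv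
    have hroot := hx.isRoot_of_lt hα hH (hr.three_le hH m₂ hr₂) m₂ hd₂ l₁
    -- A neighbour of `r` on a cycle is adjacent to `u₂`.
    have hnb : ∀ w, IsCycleEdge H r w → w ≠ u₂ → w = u₁ ∨ w = u₃ := by
      intro w hw hne
      by_contra hcon
      exact l₁.not_gt (hx.lt_of_isRoot hα hH hroot hw hr₂ hne fun h =>
        hcon (n₂ w hw.right_mem h))
    -- Two distinct cycle neighbours of `r` would both lie in `{u₁, u₂, u₃}` and differ from `v` and
    -- `r`. Adjacency to `u₂` makes `r` one of `u₁`, `u₃`, which leaves too few candidates.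
    have nocycle : ∀ w, ¬ IsCycleEdge H r w := by
      intro w hw
      obtain ⟨w', hne, hw'⟩ := hw.exists_ne
      have hB := n₂ r hr.1
      have h1 := hnb w hw
      have h2 := hnb w' hw'
      have e1 : H.Adj r w := hw.1
      have e2 : H.Adj r w' := hw'.1
      have c1 : w ≠ v := by rintro rfl; exact arv e1
      have c2 : w' ≠ v := by rintro rfl; exact arv e2
      have c3 : w ≠ r := e1.ne.symm
      have c4 : w' ≠ r := e2.ne.symm
      have c5 : w = u₂ → r = u₁ ∨ r = u₃ := by rintro rfl; exact hB e1.symm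
      have c6 : w' = u₂ → r = u₁ ∨ r = u₃ := by rintro rfl; exact hB e2.symm
      by_cases d1 : w = u₂
      · have d2 := h2 fun h => hne (h.trans d1.symm)
        have d3 := c5 d1
        grind
      · have d2 := h1 d1
        by_cases d3 : w' = u₂
        · have d4 := c6 d3
          grind
        · have d4 := h2 d3
          grind
    have e₁ : r ≠ u₁ := by rintro rfl; exact nocycle _ h₁₂
    have e₃ : r ≠ u₃ := by rintro rfl; exact nocycle _ h₂₃.symm
    have ar₂ : ¬ H.Adj r u₂ := fun h => by
      rcases n₂ r hr.1 h.symm with h | h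
      · exact e₁ h
      · exact e₃ h
    obtain ⟨w, hwB, hw, hside⟩ : ∃ w ∈ basicVertices H, IsCutEdge H r w ∧ u₂ ∈ side H r w := by
      obtain ⟨w₁, w₂, ⟨hw₁, hB₁⟩, ⟨hw₂, hB₂⟩, hne⟩ := (Set.one_lt_ncard_iff).1
        (two_le_ncard_inter_basicVertices hH hr.1 m₂ hr₂)
      have c₁ := (isCycleEdge_or_isCutEdge hw₁).resolve_left (nocycle _)
      have c₂ := (isCycleEdge_or_isCutEdge hw₂).resolve_left (nocycle _)
      rcases mem_side_or hH r w₁ u₂ with h | h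
      · exact ⟨w₁, hB₁, c₁, h⟩
      · exact ⟨w₂, hB₂, c₂, c₁.symm.side_subset hne h⟩
    obtain ⟨a, b, hab, ha, -, haw, hbw⟩ := hw.symm.exists_isCycleEdge hH hwB hr.1
    obtain ⟨-, q, hq, hadjq⟩ := hroot
    have hqs : q ∈ side H r w := mem_side_of_adj hside hadjq fun h => by
      rcases Sym2.eq_iff.1 h with h | h
      · exact hr₂ h.1.symm
      · exact hq (h.2 ▸ hr.1)
    -- The tree at `u₂` makes the side of `r` lighter than the cycle beyond `w`. Conversely,
    -- switching `r w` against the cycle edge `u₂ v` makes `w`, and with it the whole far side,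
    -- lighter than `u₂`.
    have h1 : x u₂ < x a :=
      hx.lt_of_notMem_of_mem_side hα hH hw.symm hab ha haw hbw hqs hq hside
    have l₂ : x r < x v := hx.lt_of_isRoot hα hH hr hv₂.symm hrv hr₂.symm ar₂
    have hvs : v ∈ side H r w := hv₂.mem_side hw hside
    have hw₂ : ¬ H.Adj w u₂ := hw.not_adj self_mem_side hside hr₂.symm
    have hwv : ¬ H.Adj w v := hw.not_adj self_mem_side hvs hrv
    have hw₂' : w ≠ u₂ := hw.ne_of_mem_side self_mem_side hside
    have hwv' : w ≠ v := hw.ne_of_mem_side self_mem_side hvs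
    have l₃ : x w < x v := hx.lt_of_switch hH hw.1 hv₂.1 arv hw₂ hrv.symm hw₂'
      (Or.inl (hv₂.reachable_of_isCutEdge hw)) l₁
    have l₄ : x w < x u₂ := hx.lt_of_switch hH hw.1 hv₂.symm.1 ar₂ hwv hr₂ hwv'
      (Or.inl (hv₂.symm.reachable_of_isCutEdge hw)) l₂
    exact h1.not_gt (hx.lt_of_mem_side hH hw hv₂ hside hr₂.symm hrv self_mem_side l₄ l₃ ha).1

end Cases

/-! ### The root tree, and internal paths of the basic graph. -/

/-- With `u` the only root, a walk starting outside the basic graph can enter it only at `u`, which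
gives connectedness. Cycles lie in the basic graph, which meets this set only in `u`. -/
theorem isRootTree_of_isRoot_eq {W : Type*} {H : SimpleGraph W} (hH : H.Connected) {u : W}
    (hu : u ∈ basicVertices H) (h : ∀ r, IsRoot H r → r = u) :
    IsRootTree H u (insert u (basicVertices H)ᶜ) := by
  have closed : ∀ y ∈ insert u (basicVertices H)ᶜ, y ≠ u → ∀ z, H.Adj y z →
      z ∈ insert u (basicVertices H)ᶜ := by
    intro y hy hyu z hyz
    have hyB : y ∉ basicVertices H := hy.resolve_left hyu
    by_cases hz : z ∈ basicVertices H
    · exact Or.inl (h z ⟨hz, y, hyB, hyz.symm⟩)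
    · exact Or.inr hz
  refine ⟨Set.mem_insert _ _, ⟨?_, ?_⟩, closed⟩
  · have key : ∀ y (hy : y ∈ insert u (basicVertices H)ᶜ),
        (H.induce (insert u (basicVertices H)ᶜ)).Reachable ⟨y, hy⟩ ⟨u, Set.mem_insert _ _⟩ := by
      intro y hy
      obtain ⟨p⟩ := hH.preconnected y u
      induction p with
      | nil => exact SimpleGraph.Reachable.refl _
      | @cons c d e hadj _ ih =>
        by_cases hc : c = e
        · subst hc
          exact SimpleGraph.Reachable.refl _
        · have hd := closed c hy hc d hadj
          have : (H.induce (insert e (basicVertices H)ᶜ)).Adj ⟨c, hy⟩ ⟨d, hd⟩ := hadj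
          exact this.reachable.trans (ih hu h closed hd)
    have : Nonempty ↥(insert u (basicVertices H)ᶜ) := ⟨⟨u, Set.mem_insert _ _⟩⟩
    exact ⟨fun y z => (key y y.2).trans (key z z.2).symm⟩
  · intro v c hc
    have hc' := hc.map (f := (SimpleGraph.Embedding.induce _).toHom)
      (SimpleGraph.Embedding.induce (G := H) (insert u (basicVertices H)ᶜ)).injective
    obtain ⟨a, b, -, ha, -⟩ := exists_two_of_mem_cycle hc c.start_mem_support
    have ha' : IsCycleEdge H v a := by
      refine isCycleEdge_iff.2 ⟨_, _, hc', ?_⟩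
      rw [SimpleGraph.Walk.edges_map]
      exact List.mem_map.2 ⟨_, ha, rfl⟩
    have h1 : (v : W) = u := v.2.resolve_right fun h => h ha'.left_mem
    have h2 : (a : W) = u := a.2.resolve_right fun h => h ha'.right_mem
    exact ha'.1.ne (h1.trans h2.symm)

theorem ncard_neighborSet_basicGraph {W : Type*} (H : SimpleGraph W) (v : basicVertices H) :
    ((basicGraph H).neighborSet v).ncard = (H.neighborSet v ∩ basicVertices H).ncard := by
  rw [← Set.ncard_image_of_injective _ Subtype.val_injective]
  congr 1
  ext w
  constructor
  · rintro ⟨w, hw, rfl⟩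
    exact ⟨hw, w.2⟩
  · rintro ⟨hw, hB⟩
    exact ⟨⟨w, hB⟩, hw, rfl⟩

/-- If `u₂` has degree two in the basic graph and one of its edges lies on a cycle, then so does
the other one. -/
theorem IsCycleEdge.next {W : Type*} {H : SimpleGraph W} {u₁ u₂ u₃ : W}
    (h : IsCycleEdge H u₁ u₂) (h₂₃ : H.Adj u₂ u₃) (m₃ : u₃ ∈ basicVertices H) (h₁₃ : u₁ ≠ u₃)
    (hd : (H.neighborSet u₂ ∩ basicVertices H).ncard = 2) : IsCycleEdge H u₂ u₃ := by
  obtain ⟨v, hv, hc⟩ := h.symm.exists_ne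
  rcases eq_or_eq_of_ncard_eq_two hd ⟨h.1.symm, h.left_mem⟩ ⟨h₂₃, m₃⟩ h₁₃
    ⟨hc.1, hc.right_mem⟩ with rfl | rfl
  · exact absurd rfl hv
  · exact hc

/-- The first edge of an internal path of length at least two is not a bridge. -/
theorem IsExtremalWeight.isCycleEdge_of_internal {W : Type*} [Fintype W] {α : ℝ}
    {H : SimpleGraph W} {x : W → ℝ} (hα : 0 ≤ α) (hx : IsExtremalWeight α H x)
    (hH : H.Connected) {p : W} (hp : p ∉ basicVertices H) (u : ℕ → W) {k : ℕ} (hk : 2 ≤ k)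
    (hm : ∀ i, u i ∈ basicVertices H) (hadj : ∀ i, i < k → H.Adj (u i) (u (i + 1)))
    (hne : ∀ i, i + 2 ≤ k → u i ≠ u (i + 2))
    (hd : ∀ i, 1 ≤ i → i < k → (H.neighborSet (u i) ∩ basicVertices H).ncard = 2)
    (hd₀ : 3 ≤ (H.neighborSet (u 0) ∩ basicVertices H).ncard)
    (hdk : 3 ≤ (H.neighborSet (u k) ∩ basicVertices H).ncard) : IsCycleEdge H (u 0) (u 1) := by
  refine (isCycleEdge_or_isCutEdge (hadj 0 (by omega))).resolve_right fun hcut₀ => ?_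
  -- At a vertex of basic degree two, either both edges lie on cycles or neither does, so one bridge
  -- makes the whole path bridges.
  have hcut : ∀ i, i < k → IsCutEdge H (u i) (u (i + 1)) := by
    intro i
    induction i with
    | zero => exact fun _ => hcut₀
    | succ i ih =>
      intro hi
      refine (isCycleEdge_or_isCutEdge (hadj _ hi)).resolve_left fun hc => ?_
      exact (ih (by omega)).symm.not_isCycleEdge (hc.symm.next (hadj i (by omega)).symm (hm i)
        (hne i (by omega)).symm (hd (i + 1) (by omega) hi))
  -- The vertex `p` is neither behind the first end nor between consecutive bridges, so it is pushed
  -- behind the last end, where the reversed path excludes it.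
  have hside : ∀ i, i < k → p ∈ side H (u (i + 1)) (u i) := by
    intro i
    induction i with
    | zero =>
      refine fun _ => (mem_side_or hH _ _ p).resolve_left fun h => ?_
      exact hx.false_of_mem_side_end hα hH (hcut 0 (by omega)) (hcut 1 (by omega))
        (hne 0 (by omega)) (hm _) (hm _) (hm _) hd₀ (hd 1 le_rfl (by omega)) hp h
    | succ i ih =>
      refine fun hi => (mem_side_or hH _ _ p).resolve_left fun h => ?_
      exact hx.false_of_mem_side_of_mem_side hα hH (hcut i (by omega)) (hcut (i + 1) hi)
        (hne i (by omega)) (hm _) (hm _) (hm _) hp (ih (by omega)) h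
  obtain ⟨j, rfl⟩ : ∃ j, k = j + 2 := ⟨k - 2, by omega⟩
  exact hx.false_of_mem_side_end hα hH (hcut (j + 1) (by omega)).symm (hcut j (by omega)).symm
    (hne j le_rfl).symm (hm _) (hm _) (hm _) hdk (hd (j + 1) (by omega) (by omega)) hp
    (hside (j + 1) (by omega))

theorem theorem3p11 {n t c : ℕ} (htn : t + 2 ≤ n) (hc : 1 ≤ c) (α : ℝ) (hα : 0 ≤ α)
    (π : Fin n → ℕ) (hπ : Antitone π)
    (G : SimpleGraph (Fin n)) (hG : IsThetaMaximal α (coneClass π t c) G)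
    {W : Type*} [Fintype W] (H : SimpleGraph W) [DecidableRel H.Adj] (hH : IsCyclicGraph c H)
    (hGH : Nonempty (G ≃g joinGraph (⊤ : SimpleGraph (Fin t)) H))
    (hδ : H.minDegree = 1)
    (a b : basicVertices H) (Q : (basicGraph H).Walk a b)
    (hQ : IsInternalPath (basicGraph H) Q) :
    (a = b → Q.length = 3) ∧
    (a ≠ b → Q.length ≤ 2 ∧
      (Q.length = 2 →
        H.Adj (a : W) (b : W) ∨
        ∃ T : Set W, IsRootTree H (Q.getVert 1 : W) T ∧ ∀ x, H.degree x = 1 → x ∈ T)) := by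
  classical
  obtain ⟨x, hx⟩ := exists_isExtremalWeight hα hG hH hGH
  replace hH := hH.1
  let u : ℕ → W := fun i => Q.getVert i
  have hm : ∀ i, u i ∈ basicVertices H := fun i => (Q.getVert i).2
  have hadj : ∀ i, i < Q.length → H.Adj (u i) (u (i + 1)) := fun i hi => Q.adj_getVert_succ hi
  have hd : ∀ i, 1 ≤ i → i < Q.length → (H.neighborSet (u i) ∩ basicVertices H).ncard = 2 := by
    intro i h1 h2
    rw [← ncard_neighborSet_basicGraph]
    exact hQ.inner i h1 h2
  have hd₀ : 3 ≤ (H.neighborSet (u 0) ∩ basicVertices H).ncard := by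
    have := hQ.three_le_start
    rwa [ncard_neighborSet_basicGraph, ← Q.getVert_zero] at this
  have hdk : 3 ≤ (H.neighborSet (u Q.length) ∩ basicVertices H).ncard := by
    have := hQ.three_le_end
    rwa [ncard_neighborSet_basicGraph, ← Q.getVert_length] at this
  have hpendant : ∀ p, H.degree p = 1 → p ∉ basicVertices H := by
    intro p hp hpB
    obtain ⟨w, hwB, hpw⟩ : ∃ w ∈ basicVertices H, p ≠ w := by
      by_cases h : p = u 0
      · exact ⟨u 1, hm 1, h ▸ (hadj 0 hQ.one_le_length).ne⟩
      · exact ⟨u 0, hm 0, h⟩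
    have h2 := two_le_ncard_inter_basicVertices hH hpB hwB hpw
    have h3 : (H.neighborSet p ∩ basicVertices H).ncard ≤ (H.neighborSet p).ncard :=
      Set.ncard_le_ncard Set.inter_subset_left
    have h4 : (H.neighborSet p).ncard = H.degree p := by
      rw [Set.ncard_eq_toFinset_card', ← SimpleGraph.card_neighborFinset_eq_degree,
        SimpleGraph.neighborFinset_def]
    omega
  have := hH.nonempty
  obtain ⟨p, hp⟩ := H.exists_minimal_degree_vertex
  have hpB := hpendant p (hp.symm.trans hδ)
  obtain ⟨r, hr⟩ := exists_isRoot hH hpB (hm 0)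
  -- A closed path needs length four, and an open one length three, for its first four vertices to
  -- be distinct.
  have hfour : 4 ≤ Q.length ∨ (3 ≤ Q.length ∧ a ≠ b) → IsCycleEdge H (u 0) (u 1) →
      u 0 ≠ u 2 → u 1 ≠ u 3 → u 0 ≠ u 3 → False := by
    intro hlen h₀₁ h₀₂ h₁₃ h₀₃
    have h₁₂ := h₀₁.next (hadj 1 (by omega)) (hm 2) h₀₂ (hd 1 (by omega) (by omega))
    have h₂₃ := h₁₂.next (hadj 2 (by omega)) (hm 3) h₁₃ (hd 2 (by omega) (by omega))
    exact hx.false_of_four_path hα hH h₀₁ h₁₂ h₂₃ h₀₂ h₁₃ h₀₃ (hd 1 (by omega) (by omega))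
      (hd 2 (by omega) (by omega)) hr
  constructor
  · intro hab
    subst hab
    have hcyc : Q.IsCycle := hQ.isCycle_of_eq rfl
    have h3 := hcyc.three_le_length
    by_contra hne
    have hinj : ∀ i j, i < j → j < Q.length → u i ≠ u j := by
      intro i j hij hj h
      have := hcyc.getVert_injOn' (x₁ := i) (x₂ := j) (by show i ≤ _; omega)
        (by show j ≤ _; omega) (Subtype.val_injective h)
      omega
    have h₀₁ : IsCycleEdge H (u 0) (u 1) := by
      let f : basicGraph H →g H := ⟨Subtype.val, fun h => h⟩
      refine isCycleEdge_iff.2 ⟨_, _, hcyc.map (f := f) Subtype.val_injective, ?_⟩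
      rw [SimpleGraph.Walk.edges_map]
      exact List.mem_map.2 ⟨_, SimpleGraph.Walk.adj_toSubgraph_iff_mem_edges.1
        (Q.toSubgraph_adj_getVert (i := 0) (by omega)), rfl⟩
    exact hfour (Or.inl (by omega)) h₀₁ (hinj 0 2 (by omega) (by omega))
      (hinj 1 3 (by omega) (by omega)) (hinj 0 3 (by omega) (by omega))
  · intro hab
    have hpath := hQ.isPath_of_ne hab
    have hinj : ∀ i j, i < j → j ≤ Q.length → u i ≠ u j := by
      intro i j hij hj h
      have := hpath.getVert_injOn (x₁ := i) (x₂ := j) (by show i ≤ _; omega)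
        (by show j ≤ _; omega) (Subtype.val_injective h)
      omega
    have h₀₁ : 2 ≤ Q.length → IsCycleEdge H (u 0) (u 1) := fun hk =>
      hx.isCycleEdge_of_internal hα hH hpB u hk hm hadj
        (fun i hi => hinj i (i + 2) (by omega) hi) hd hd₀ hdk
    refine ⟨?_, fun hk => ?_⟩
    · by_contra! hk
      exact hfour (Or.inr ⟨hk, hab⟩) (h₀₁ (by omega)) (hinj 0 2 (by omega) (by omega))
        (hinj 1 3 (by omega) (by omega)) (hinj 0 3 (by omega) (by omega))
    · by_cases h₀₂ : H.Adj (a : W) (b : W)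
      · exact Or.inl h₀₂
      · refine Or.inr ⟨_, isRootTree_of_isRoot_eq hH (hm 1) fun r hr => ?_,
          fun p hp => Or.inr (hpendant p hp)⟩
        by_contra hne
        have hu0 : u 0 = a := by simp [u]
        have hu2 : u 2 = b := by rw [← hk]; simp [u]
        have hd₂ : 3 ≤ (H.neighborSet (u 2)).ncard := by
          rw [hk] at hdk
          exact hdk.trans (Set.ncard_le_ncard Set.inter_subset_left)
        have hd₁ := hd 1 le_rfl (by omega)
        have h02 := hinj 0 2 (by omega) (by omega)
        exact hx.false_of_isRoot_of_ne hα hH (h₀₁ (by omega))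
          ((h₀₁ (by omega)).next (hadj 1 (by omega)) (hm 2) h02 hd₁) h02
          (by rwa [hu0, hu2]) hd₁ hd₂ hr hne
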